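/- **Setting.** $X$ is an arbitrary set, a concept is a map $X\to\{0,1\}$, and $C$ is a non-empty class of concepts over $X$ with finite VC dimension $\mathrm{VC}(C)\ge 1$. Distributions on $X$ and output distributions of randomized algorithms are discrete. A randomized algorithm $\mathcal B$ that maps databases in $(X\times\{0,1,\bot\})^N$ to hypotheses $X\to\{0,1\}$ is *$(\epsilon,\delta)$-differentially private* if $\Pr[\mathcal B(S_1)\in F]\le e^{\epsilon}\Pr[\mathcal B(S_2)\in F]+\delta$ for every set $F$ of hypotheses and all databases $S_1,S_2$ that differ in exactly one entry. It is an *$(\alpha,\beta,\epsilon,\delta,N,m)$-PSSL* for $C$ if it is $(\epsilon,\delta)$-differentially private and, for all $c\in C$ and all distributions $\mu$ on $X$, when it is run on $N$ i.i.d. points from $\mu$, the first $m$ of them labeled by $c$ and the others unlabeled ($\bot$), its output $h$ satisfies $\Pr_{x\sim\mu}[h(x)\ne c(x)]>\alpha$ with probability at most $\beta$. **Algorithm LabelBoost.** Given $\alpha,\beta$, $C$ and a base algorithm $\mathcal A$ on databases of size $n$, the input is a database $S$ of size $m$ (the labeled part) followed by a database $D$ of size $90000n$ (the unlabeled part). Set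 $i=1$. While $|S|<300n$: 1. Put $\alpha_i=\frac{\alpha}{10\cdot 2^i}$, $\beta_i=\frac{\beta}{4\cdot 2^i}$ and $v=\max\bigl\{0,\bigl\lfloor\min\{30000n,\ \beta_i\mathrm{VC}(C)e^{\alpha_i|S|/(200\mathrm{VC}(C))}-|S|\}\bigr\rfloor\bigr\}$. Move the first $v$ elements of $D$ into $T$; fail if $|D|<v$. 2. Replace $S$ by $\lfloor |S|/100\rfloor$ of its entries, and $T$ by $\lfloor |T|/100\rfloor$ of its entries, chosen uniformly at random without replacement. 3. Let $P$ be the set of points of $X$ occurring in $S\circ T$, and let $H\subseteq C$ contain, for each pattern in $\{c|_P : c\in C\}$, one arbitrarily chosen concept of $C$ with that pattern on $P$. Choose $h\in H$ with probability proportional to $\exp\bigl(\frac12|\{(x,y)\in S: h(x)=y\}|\bigr)$ (entries counted with multiplicity). Relabel all entries of $S\circ T$ by $h$, let $S$ be the result, and increase $i$ by one. After the loop, keep $\lfloor |S|/300\rfloor$ entries of $S$ chosen uniformly at random without replacement, draw $n$ i.i.d. uniform entries (with replacement) from them, and output the result of $\mathcal A$ on these. A failed (or non-terminating) execution outputs a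 fixed hypothesis. **Theorem.** There is an absolute constant $K>0$ such that the following holds for all $X$ and $C$ as above, all $\alpha,\beta\in(0,1)$, $\delta\ge 0$ and $n\in\mathbb N$. If $\mathcal A$ is an $(\alpha,\beta,1,\delta,n,n)$-PSSL for $C$, then there is an integer $m\ge 0$ with $$m\le K\cdot\frac{\mathrm{VC}(C)}{\alpha}\log\frac{1}{\alpha\beta}$$ such that LabelBoost applied to $\mathcal A$, with $m$ labeled and $90000n$ unlabeled examples, is an $(11\alpha,2\beta,1,41\delta,m+90000n,m)$-PSSL for $C$. The number of unlabeled examples is thus $O(n)$; and if $\frac{\mathrm{VC}(C)}{\alpha}\log\frac1{\alpha\beta}\le n$, then the total number of examples satisfies $m+90000n\le Kn$. -/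

import Mathlib

open scoped ENNReal

noncomputable section

namespace PrivateSSL

/-! ### Concept classes and the VC dimension -/

/-- A concept (or hypothesis) over the domain `X`. -/
abbrev Concept (X : Type*) := X → Bool

/-- An entry of a partially labeled database: a point of `X` with a label in `{0, 1, ⊥}`
(`none` is `⊥`). -/
abbrev Entry (X : Type*) := X × Option Bool

/-- A partially labeled database of size `n`. -/
abbrev Database (X : Type*) (n : ℕ) := Fin n → Entry X

/-- `C` shatters the finite set `B` if it realizes every dichotomy of `B`. -/
def Shatters {X : Type*} (C : Set (Concept X)) (B : Finset X) : Prop :=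
  ∀ f : X → Bool, ∃ c ∈ C, ∀ x ∈ B, c x = f x

/-- The VC dimension: the supremum of the sizes of the finite sets that `C` shatters. -/
def vcDim {X : Type*} (C : Set (Concept X)) : ℕ∞ :=
  ⨆ (B : Finset X) (_ : Shatters C B), (B.card : ℕ∞)

/-! ### Private semi-supervised learners -/

/-- A randomized algorithm that maps a partially labeled database of size `n` to a hypothesis. -/
abbrev Learner (X : Type*) (n : ℕ) := Database X n → PMF (Concept X)

/-- The databases `S₁` and `S₂` differ in exactly one entry. -/
def Neighboring {X : Type*} {n : ℕ} (S₁ S₂ : Database X n) : Prop :=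
  ∃ i, S₁ i ≠ S₂ i ∧ ∀ j, j ≠ i → S₁ j = S₂ j

/-- `(ε, δ)`-differential privacy. -/
def IsDP {X : Type*} {n : ℕ} (ε δ : ℝ) (A : Learner X n) : Prop :=
  ∀ S₁ S₂ : Database X n, Neighboring S₁ S₂ → ∀ F : Set (Concept X),
    (A S₁).toOuterMeasure F ≤
      ENNReal.ofReal (Real.exp ε) * (A S₂).toOuterMeasure F + ENNReal.ofReal δ

/-- The generalization error `Pr_{x ∼ μ}[h x ≠ c x]`. -/
def genError {X : Type*} (μ : PMF X) (c h : Concept X) : ℝ≥0∞ :=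
  μ.toOuterMeasure {x | h x ≠ c x}

/-- `n` independent samples from `μ`. -/
def iidSample {X : Type*} (μ : PMF X) : (n : ℕ) → PMF (Fin n → X)
  | 0 => PMF.pure Fin.elim0
  | n + 1 => μ.bind fun x => (iidSample μ n).map fun xs => Fin.cons x xs

/-- The database on the points `x` whose first `m` entries are labeled by `c` and whose other
entries are unlabeled. -/
def partialLabel {X : Type*} {n : ℕ} (c : Concept X) (m : ℕ) (x : Fin n → X) : Database X n :=
  fun i => (x i, if (i : ℕ) < m then some (c (x i)) else none)

/-- `A` is an `(α, β, n, m)`-SSL for `C`. -/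
def IsSSL {X : Type*} (α β : ℝ) (n m : ℕ) (C : Set (Concept X)) (A : Learner X n) : Prop :=
  ∀ c ∈ C, ∀ μ : PMF X,
    ((iidSample μ n).bind fun x => A (partialLabel c m x)).toOuterMeasure
      {h | ENNReal.ofReal α < genError μ c h} ≤ ENNReal.ofReal β

/-- `A` is an `(α, β, ε, δ, n, m)`-PSSL for `C`. -/
def IsPSSL {X : Type*} (α β ε δ : ℝ) (n m : ℕ) (C : Set (Concept X)) (A : Learner X n) : Prop :=
  IsSSL α β n m C A ∧ IsDP ε δ A

/-! ### The exponential mechanism -/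

/-- `q(S, h)`: the number of entries of `S` whose label is the one given by `h`. -/
def score {X : Type*} {s : ℕ} (S : Database X s) (h : Concept X) : ℕ :=
  (Finset.univ.filter fun i => (S i).2 = some (h (S i).1)).card

open Classical in
/-- The unnormalized weight `exp (ε q(S, h) / 2)` of `h ∈ H`. -/
def expWeight {X : Type*} {s : ℕ} (ε : ℝ) (H : Finset (Concept X)) (S : Database X s)
    (h : Concept X) : ℝ≥0∞ :=
  if h ∈ H then ENNReal.ofReal (Real.exp (ε * score S h / 2)) else 0

theorem tsum_expWeight_ne_zero {X : Type*} {s : ℕ} (ε : ℝ) (H : Finset (Concept X))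
    (hH : H.Nonempty) (S : Database X s) : ∑' h, expWeight ε H S h ≠ 0 := by
  obtain ⟨h, hh⟩ := hH
  intro h0
  have h1 := ENNReal.tsum_eq_zero.1 h0 h
  simp [expWeight, hh] at h1
  exact absurd h1 (not_le.2 (Real.exp_pos _))

theorem tsum_expWeight_ne_top {X : Type*} {s : ℕ} (ε : ℝ) (H : Finset (Concept X))
    (S : Database X s) : ∑' h, expWeight ε H S h ≠ ∞ := by
  rw [tsum_eq_sum (s := H) (fun h hh => by simp [expWeight, hh])]
  refine ENNReal.sum_ne_top.2 fun h hh => ?_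
  simp [expWeight, hh]

/-- The exponential mechanism: choose `h ∈ H` with probability proportional to
`exp (ε q(S, h) / 2)`. -/
def expMechanism {X : Type*} {s : ℕ} (ε : ℝ) (H : Finset (Concept X)) (hH : H.Nonempty)
    (S : Database X s) : PMF (Concept X) :=
  PMF.normalize (expWeight ε H S) (tsum_expWeight_ne_zero ε H hH S) (tsum_expWeight_ne_top ε H S)

/-! ### `LabelBoostProcedure` -/

/-- The set of points that appear in a database. -/
def points {X : Type*} {s : ℕ} (B : Database X s) : Set X := Set.range fun i => (B i).1

instance finitePoints {X : Type*} {s : ℕ} (B : Database X s) : Finite (points B) :=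
  inferInstanceAs (Finite (Set.range fun i => (B i).1))

/-- The projection `Π_C(P)` of `C` on `P`. -/
def projection {X : Type*} (C : Set (Concept X)) (P : Set X) : Set (P → Bool) :=
  (fun (c : Concept X) (p : P) => c p) '' C

/-- For every pattern `z ∈ Π_C(P)`, one (arbitrary) concept of `C` that agrees with `z` on `P`. -/
def representative {X : Type*} (C : Set (Concept X)) (P : Set X) (z : projection C P) :
    Concept X :=
  Classical.choose z.2

/-- The finite solution set `H` of representatives of the patterns in `Π_C(P)`. -/
def hypotheses {X : Type*} (C : Set (Concept X)) (P : Set X) [Finite P] : Finset (Concept X) :=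
  (Set.finite_range (representative C P)).toFinset

theorem hypotheses_nonempty {X : Type*} {C : Set (Concept X)} (hC : C.Nonempty) (P : Set X)
    [Finite P] : (hypotheses C P).Nonempty := by
  obtain ⟨c, hc⟩ := hC
  exact ⟨representative C P ⟨_, c, hc, rfl⟩, by simp [hypotheses]⟩

/-- Replace every label by the one given by `h`. -/
def relabel {X : Type*} {s : ℕ} (h : Concept X) (B : Database X s) : Database X s :=
  fun i => ((B i).1, some (h (B i).1))

/-- `LabelBoostProcedure` on `S ∘ T ∘ D`. Its output is `(S ∘ T)^h ∘ D`; as `D` is neither read nor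
changed, only the new `(S ∘ T)^h` is returned. -/
def labelBoostProcedure {X : Type*} {s t : ℕ} (C : Set (Concept X)) (hC : C.Nonempty)
    (S : Database X s) (T : Database X t) : PMF (Database X (s + t)) :=
  (expMechanism 1 (hypotheses C (points (Fin.append S T))) (hypotheses_nonempty hC _) S).map
    fun h => relabel h (Fin.append S T)

/-! ### `LabelBoost` -/

/-- Keep `⌊s / r⌋` entries of `B`, chosen uniformly at random without replacement and listed in
random order; the other entries are deleted. -/
def subsample {X : Type*} {s : ℕ} (r : ℕ) (B : Database X s) : PMF (Database X (s / r)) :=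
  haveI : Nonempty (Fin (s / r) ↪ Fin s) := ⟨Fin.castLEEmb (Nat.div_le_self s r)⟩
  (PMF.uniformOfFintype (Fin (s / r) ↪ Fin s)).map fun e j => B (e j)

/-- `n` entries drawn independently and uniformly (with replacement) from `B`. -/
def resample {X : Type*} {s : ℕ} (n : ℕ) (h : n ≤ s) (B : Database X s) : PMF (Database X n) :=
  haveI : Nonempty (Fin n → Fin s) := ⟨Fin.castLE h⟩
  (PMF.uniformOfFintype (Fin n → Fin s)).map fun e j => B (e j)

/-- The final steps: keep a fraction `1 / 300` of `S` at random, draw `n` i.i.d. entries from it,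
and execute `A` on them. -/
def finalStep {X : Type*} {n s : ℕ} (A : Learner X n) (S : Database X s) (h : 300 * n ≤ s) :
    PMF (Concept X) :=
  (subsample 300 S).bind fun S₃ =>
    (resample n ((Nat.le_div_iff_mul_le (by norm_num)).2 (by omega)) S₃).bind A

/-- The number `v` of elements that iteration `i` moves from `D` to `T`, rounded down, when `s` is
the size of `S` and `d` the VC dimension. -/
def stretchSize (α β : ℝ) (d n i s : ℕ) : ℕ :=
  ⌊min (30000 * n : ℝ)
    (β / (4 * 2 ^ i) * d * Real.exp (α / (10 * 2 ^ i) * s / (200 * d)) - s)⌋₊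

/-- The outcome of a failed execution: a fixed hypothesis. -/
def failure {X : Type*} : PMF (Concept X) := PMF.pure fun _ => false

/-- The while loop of `LabelBoost`, started at iteration `i` with the labeled part `S` and the
unlabeled part `D`, followed by the final steps. The first argument bounds the number of tests of
the loop condition; the loop fails when it is exhausted. -/
def labelBoostLoop {X : Type*} {n : ℕ} (α β : ℝ) (C : Set (Concept X)) (hC : C.Nonempty)
    (A : Learner X n) :
    ℕ → (i : ℕ) → {s u : ℕ} → Database X s → Database X u → PMF (Concept X)
  | 0, _, _, _, _, _ => failure
  | fuel + 1, i, s, u, S, D =>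
    if hs : 300 * n ≤ s then finalStep A S hs
    else
      let v := stretchSize α β (vcDim C).toNat n i s
      if hv : v ≤ u then
        let T : Database X v := fun j => D (Fin.castLE hv j)
        let D' : Database X (u - v) := fun j => D ⟨v + j, by omega⟩
        (subsample 100 S).bind fun S₁ =>
          (subsample 100 T).bind fun T₁ =>
            (labelBoostProcedure C hC S₁ T₁).bind fun S₂ =>
              labelBoostLoop α β C hC A fuel (i + 1) S₂ D'
      else failure

/-- `LabelBoost` applied to the base learner `A`. The input consists of a database `S` of size `m`
followed by a database `D` of size `90000 n`. An iteration with `|S| + |T| > 0` decreases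
`|S| + |D|`, and one with `|S| + |T| = 0` changes nothing, for ever; so the loop terminates at all
only if it does so within `m + 90000 n + 1` tests of its condition. -/
def labelBoost {X : Type*} {n : ℕ} (α β : ℝ) (C : Set (Concept X)) (hC : C.Nonempty)
    (A : Learner X n) (m : ℕ) : Learner X (m + 90000 * n) :=
  fun B => labelBoostLoop α β C hC A (m + 90000 * n + 1) 1
    (fun i : Fin m => B (Fin.castAdd (90000 * n) i))
    (fun j : Fin (90000 * n) => B (Fin.natAdd m j))

end PrivateSSL

end

noncomputable section

namespace PrivateSSL

/-! ### Expectations of nonnegative functions under discrete distributions -/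

/-! Privacy and accuracy are independent arguments.

Privacy (`labelBoostLoop_stable`). The solution set `H` depends on the data. Still, when one entry
of `S ∘ T` changes, the old representatives map at most two-to-one to new ones that agree with them
at all other entries, and scores move by at most 1. So a relabelling multiplies probabilities by at
most 4e ≤ 11 (`expect_expMechanism_le`). If the rest of the loop is stable with factor e and summand
δ, one relabelling makes this 11e and 11δ, and keeping one percent of the entries brings it down to
1 + 11e/99 ≤ 2 < e and 11δ/99 ≤ δ (`expect_subsample_le`). The pair (e, δ) thus reproduces itself,
and no loss accumulates over the iterations. The final step is alike: drawing with replacement costs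
21, which the fraction 1/300 absorbs.

Accuracy. The labels come from a concept of `C` chosen after seeing the points, so the labelled
sample is not an ordinary one. The induction therefore runs on `loopLoss`, where the i.i.d. points
are labelled by the worst concept of `C` near `c`. In one iteration (`loopLoss_succ_le`) the
exponential mechanism moves the labelling concept by more than 10αᵢ with probability at most βᵢ;
this rests on a symmetrization bound (`piExpect_iSup_penalty_le`) and on Sauer–Shelah. The distances
10αᵢ = α/2^i sum to at most α.

In the final step (`expect_iSup_resample_le`) the learner is accurate on the uniform distribution
over the kept points, but its hypotheses need not have bounded VC dimension. What saves
generalization is that a resample of size n ≤ N misses about a quarter of the N points or more. The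
hypothesis depends on the unseen points only through the labelling of the seen ones, for which there
are few possibilities. An error above 10α would typically show at least 10α · N/4 = 2.5αN
disagreements among the unseen points, against the αN that are allowed.

Sizes (`sample_growth`, `loopLoss_le`). Once |S| is a large multiple of 4^i (d/α) log(1/(αβ)), each
iteration multiplies |S| by more than 4 or reaches 300n, so the unlabelled examples used form a
geometric series of sum O(n). -/

/-- The expectation of `f` under the discrete distribution `p`. -/
def expect {α : Type*} (p : PMF α) (f : α → ℝ≥0∞) : ℝ≥0∞ := ∑' a, p a * f a

section Expect

variable {α β : Type*}

theorem expect_mono (p : PMF α) {f g : α → ℝ≥0∞} (h : ∀ a, f a ≤ g a) :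
    expect p f ≤ expect p g :=
  ENNReal.tsum_le_tsum fun a => mul_le_mul_right (h a) _

theorem expect_mono_support (p : PMF α) {f g : α → ℝ≥0∞} (h : ∀ a ∈ p.support, f a ≤ g a) :
    expect p f ≤ expect p g := by
  refine ENNReal.tsum_le_tsum fun a => ?_
  by_cases ha : p a = 0
  · simp [ha]
  · exact mul_le_mul_right (h a ha) _

theorem expect_add (p : PMF α) (f g : α → ℝ≥0∞) :
    expect p (fun a => f a + g a) = expect p f + expect p g := by
  simp only [expect, mul_add, ENNReal.tsum_add]

theorem expect_const_mul (p : PMF α) (c : ℝ≥0∞) (f : α → ℝ≥0∞) :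
    expect p (fun a => c * f a) = c * expect p f := by
  simp only [expect, ← ENNReal.tsum_mul_left, mul_left_comm]

theorem expect_mul_const (p : PMF α) (c : ℝ≥0∞) (f : α → ℝ≥0∞) :
    expect p (fun a => f a * c) = expect p f * c := by
  simp only [expect, ← ENNReal.tsum_mul_right, mul_assoc]

theorem expect_const (p : PMF α) (c : ℝ≥0∞) : expect p (fun _ => c) = c := by
  simp only [expect, ENNReal.tsum_mul_right, p.tsum_coe, one_mul]

theorem expect_le_mul_add (p : PMF α) {f g : α → ℝ≥0∞} {c d : ℝ≥0∞}
    (h : ∀ a, f a ≤ c * g a + d) : expect p f ≤ c * expect p g + d := by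
  refine (expect_mono p h).trans_eq ?_
  rw [expect_add, expect_const_mul, expect_const]

theorem expect_add_const (p : PMF α) (f : α → ℝ≥0∞) (c : ℝ≥0∞) :
    expect p (fun a => f a + c) = expect p f + c := by
  rw [expect_add, expect_const]

theorem expect_le (p : PMF α) {f : α → ℝ≥0∞} {c : ℝ≥0∞} (h : ∀ a, f a ≤ c) : expect p f ≤ c :=
  (expect_mono p h).trans (expect_const p c).le

theorem expect_pure (a : α) (f : α → ℝ≥0∞) : expect (PMF.pure a) f = f a := by
  classical
  rw [expect, tsum_eq_single a]
  · simp
  · intro b hb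
    simp [hb]

theorem expect_bind (p : PMF α) (q : α → PMF β) (f : β → ℝ≥0∞) :
    expect (p.bind q) f = expect p fun a => expect (q a) f := by
  simp only [expect, PMF.bind_apply, ← ENNReal.tsum_mul_right, ← ENNReal.tsum_mul_left]
  rw [ENNReal.tsum_comm]
  simp only [mul_assoc]

theorem expect_map (p : PMF α) (g : α → β) (f : β → ℝ≥0∞) :
    expect (p.map g) f = expect p fun a => f (g a) := by
  rw [PMF.map, expect_bind]
  simp only [Function.comp_apply, expect_pure]

theorem toOuterMeasure_eq_expect (p : PMF α) (s : Set α) :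
    p.toOuterMeasure s = expect p (s.indicator fun _ => 1) := by
  classical
  rw [PMF.toOuterMeasure_apply, expect]
  refine tsum_congr fun a => ?_
  by_cases ha : a ∈ s <;> simp [ha]

theorem toOuterMeasure_bind (p : PMF α) (q : α → PMF β) (s : Set β) :
    (p.bind q).toOuterMeasure s = expect p fun a => (q a).toOuterMeasure s := by
  simp only [toOuterMeasure_eq_expect, expect_bind]

theorem toOuterMeasure_le_one (p : PMF α) (s : Set α) : p.toOuterMeasure s ≤ 1 := by
  rw [toOuterMeasure_eq_expect]
  refine (expect_mono p fun a => ?_).trans (expect_const p 1).le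
  exact Set.indicator_le_self' (fun _ _ => zero_le) a

theorem expect_uniformOfFintype [Fintype α] [Nonempty α] (f : α → ℝ≥0∞) :
    expect (PMF.uniformOfFintype α) f = (Fintype.card α : ℝ≥0∞)⁻¹ * ∑ a, f a := by
  simp only [expect, PMF.uniformOfFintype_apply, tsum_fintype, Finset.mul_sum]

end Expect

/-! ### Product distributions -/

/-- The expectation of `F` under the product distribution `μ ^ ι`. -/
def piExpect {X ι : Type*} [Fintype ι] (μ : PMF X) (F : (ι → X) → ℝ≥0∞) : ℝ≥0∞ :=
  ∑' x : ι → X, (∏ i, μ (x i)) * F x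

section PiExpect

variable {X ι κ : Type*} [Fintype ι] [Fintype κ] (μ : PMF X)

theorem iidSample_apply : ∀ (n : ℕ) (x : Fin n → X), iidSample μ n x = ∏ i, μ (x i)
  | 0, x => by
    have : x = Fin.elim0 := Subsingleton.elim _ _
    simp [iidSample, this]
  | n + 1, x => by
    classical
    rw [iidSample, PMF.bind_apply, tsum_eq_single (x 0)]
    · rw [PMF.map_apply, tsum_eq_single (Fin.tail x)]
      · simp [iidSample_apply n, Fin.prod_univ_succ, Fin.tail]
      · intro y hy
        rw [if_neg]
        intro h
        exact hy (by rw [h, Fin.tail_cons])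
    · intro a ha
      rw [PMF.map_apply]
      simp only [mul_eq_zero, ENNReal.tsum_eq_zero, ite_eq_right_iff]
      right
      rintro y rfl
      simp at ha

theorem expect_iidSample (n : ℕ) (F : (Fin n → X) → ℝ≥0∞) :
    expect (iidSample μ n) F = piExpect μ F := by
  simp only [expect, piExpect, iidSample_apply]

theorem piExpect_comp_equiv (e : ι ≃ κ) (F : (ι → X) → ℝ≥0∞) :
    piExpect μ (fun x : κ → X => F (x ∘ e)) = piExpect μ F := by
  rw [piExpect, piExpect, ← (Equiv.arrowCongr e (Equiv.refl X)).tsum_eq]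
  refine tsum_congr fun x => ?_
  congr 1
  · rw [← e.prod_comp]
    simp [Equiv.arrowCongr]
  · congr 1
    ext i
    simp [Equiv.arrowCongr]

theorem piExpect_sum (F : (ι ⊕ κ → X) → ℝ≥0∞) :
    piExpect μ F = piExpect μ fun x : ι → X => piExpect μ fun y : κ → X => F (Sum.elim x y) := by
  simp only [piExpect, ← ENNReal.tsum_mul_left]
  rw [← (Equiv.sumArrowEquivProdArrow ι κ X).symm.tsum_eq, ENNReal.tsum_prod']
  refine tsum_congr fun x => tsum_congr fun y => ?_
  simp [Equiv.sumArrowEquivProdArrow, mul_assoc]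

theorem piExpect_mono {F G : (ι → X) → ℝ≥0∞} (h : ∀ x, F x ≤ G x) : piExpect μ F ≤ piExpect μ G :=
  ENNReal.tsum_le_tsum fun a => mul_le_mul_right (h a) _

theorem piExpect_const_mul (c : ℝ≥0∞) (F : (ι → X) → ℝ≥0∞) :
    piExpect μ (fun x => c * F x) = c * piExpect μ F := by
  simp only [piExpect, ← ENNReal.tsum_mul_left, mul_left_comm]

theorem piExpect_add (F G : (ι → X) → ℝ≥0∞) :
    piExpect μ (fun x => F x + G x) = piExpect μ F + piExpect μ G := by
  simp only [piExpect, mul_add, ENNReal.tsum_add]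

theorem piExpect_finset_sum {τ : Type*} (s : Finset τ) (F : τ → (ι → X) → ℝ≥0∞) :
    piExpect μ (fun x => ∑ t ∈ s, F t x) = ∑ t ∈ s, piExpect μ (F t) := by
  simp only [piExpect, Finset.mul_sum]
  exact Summable.tsum_finsetSum fun _ _ => ENNReal.summable

theorem piExpect_expect_comm {τ : Type*} (p : PMF τ) (F : τ → (ι → X) → ℝ≥0∞) :
    piExpect μ (fun x => expect p fun t => F t x) = expect p fun t => piExpect μ (F t) := by
  simp only [piExpect, expect, ← ENNReal.tsum_mul_left]
  rw [ENNReal.tsum_comm]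
  simp only [mul_left_comm]

theorem piExpect_const (c : ℝ≥0∞) : piExpect (ι := ι) μ (fun _ => c) = c := by
  refine (piExpect_comp_equiv μ (Fintype.equivFin ι) fun _ => c).symm.trans ?_
  rw [← expect_iidSample, expect_const]

/-- A factor of a product distribution is again a product distribution. -/
theorem piExpect_comp_embedding (e : ι ↪ κ) (F : (ι → X) → ℝ≥0∞) :
    piExpect μ (fun x : κ → X => F (x ∘ e)) = piExpect μ F := by
  classical
  let σ : ι ⊕ ((Set.range e)ᶜ : Set κ) ≃ κ :=
    (Equiv.sumCongr (Equiv.ofInjective e e.injective) (Equiv.refl _)).trans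
      (Equiv.Set.sumCompl (Set.range e))
  rw [← piExpect_comp_equiv μ σ.symm, piExpect_sum]
  refine (congrArg _ (funext fun x => ?_)).trans rfl
  rw [← piExpect_const (ι := ((Set.range e)ᶜ : Set κ)) μ (F x)]
  refine congrArg _ (funext fun y => ?_)
  congr 1
  ext i
  have : σ.symm (e i) = Sum.inl i := by
    rw [Equiv.symm_apply_eq]
    simp [σ]
  simp [this]

theorem piExpect_fin_prod (f : X → ℝ≥0∞) :
    ∀ n : ℕ, piExpect μ (fun x : Fin n → X => ∏ i, f (x i)) = expect μ f ^ n
  | 0 => by simp [piExpect]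
  | n + 1 => by
    rw [← expect_iidSample, iidSample, expect_bind]
    simp only [expect_map, Fin.prod_univ_succ, Fin.cons_zero, Fin.cons_succ, expect_const_mul]
    rw [expect_mul_const, expect_iidSample, piExpect_fin_prod f n, pow_succ']

theorem piExpect_prod (f : X → ℝ≥0∞) :
    piExpect μ (fun x : ι → X => ∏ i, f (x i)) = expect μ f ^ Fintype.card ι := by
  rw [← piExpect_fin_prod μ f,
    ← piExpect_comp_equiv μ (Fintype.equivFin ι).symm fun x : Fin (Fintype.card ι) → X =>
      ∏ i, f (x i)]
  refine congrArg _ (funext fun x => ?_)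
  exact ((Fintype.equivFin ι).symm.prod_comp fun i => f (x i)).symm

end PiExpect

/-! ### Stability under the change of one entry -/

/-- The tuples `B` and `B'` agree at every index other than `j`. -/
def AgreeOff {α : Type*} {n : ℕ} (j : Fin n) (B B' : Fin n → α) : Prop :=
  ∀ k, k ≠ j → B k = B' k

theorem AgreeOff.symm {α : Type*} {n : ℕ} {j : Fin n} {B B' : Fin n → α} (h : AgreeOff j B B') :
    AgreeOff j B' B := fun k hk => (h k hk).symm

/-- `φ` changes by at most a factor `E` and a summand `Δ` when one entry of its argument changes. -/
def Stable {α : Type*} {n : ℕ} (E Δ : ℝ≥0∞) (φ : (Fin n → α) → ℝ≥0∞) : Prop :=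
  ∀ B B' j, AgreeOff j B B' → φ B ≤ E * φ B' + Δ

/-! ### Sampling without replacement -/

section Subsample

variable {X : Type*}

theorem expect_subsample {s : ℕ} (r : ℕ) (B : Database X s) (φ : Database X (s / r) → ℝ≥0∞) :
    expect (subsample r B) φ =
      (Fintype.card (Fin (s / r) ↪ Fin s) : ℝ≥0∞)⁻¹ *
        ∑ e : Fin (s / r) ↪ Fin s, φ fun j => B (e j) := by
  have : Nonempty (Fin (s / r) ↪ Fin s) := ⟨Fin.castLEEmb (Nat.div_le_self s r)⟩
  rw [subsample, expect_map, expect_uniformOfFintype]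

/-- Double counting: exchanging `i` and `l` matches the samples that hit `i` and miss `l` with those
that hit `l` and miss `i`. Matched samples, taken from `S` and `S'`, differ only in the position of
the exchanged index. The factors `s - k` and `k` count the choices of `l`. -/
theorem sum_embedding_hit_le {α : Type*} {k s : ℕ} {φ : (Fin k → α) → ℝ≥0∞} {E Δ : ℝ≥0∞}
    (hφ : Stable E Δ φ) {S S' : Fin s → α} {i : Fin s} (h : AgreeOff i S S') :
    ((s - k : ℕ) : ℝ≥0∞) *
        ∑ e : Fin k ↪ Fin s with i ∈ Finset.univ.map e, φ (fun j => S (e j)) ≤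
      k * ∑ e : Fin k ↪ Fin s with i ∉ Finset.univ.map e, (E * φ (fun j => S' (e j)) + Δ) := by
  have hcard : ∀ e : Fin k ↪ Fin s, (Finset.univ.filter fun l => l ∉ Finset.univ.map e).card
      = s - k := by
    intro e
    rw [Finset.filter_notMem_eq_sdiff, Finset.card_sdiff_of_subset (Finset.subset_univ _)]
    simp
  have h1 : ((s - k : ℕ) : ℝ≥0∞) *
        ∑ e : Fin k ↪ Fin s with i ∈ Finset.univ.map e, φ (fun j => S (e j)) =
      ∑ l : Fin s, ∑ e : Fin k ↪ Fin s with i ∈ Finset.univ.map e ∧ l ∉ Finset.univ.map e,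
        φ (fun j => S (e j)) := by
    simp only [Finset.sum_filter]
    rw [Finset.sum_comm, Finset.mul_sum]
    refine Finset.sum_congr rfl fun e _ => ?_
    by_cases hi : i ∈ Finset.univ.map e
    · simp only [hi, true_and, if_true]
      rw [← Finset.sum_filter, Finset.sum_const, hcard, nsmul_eq_mul]
    · simp only [hi, false_and, if_false, mul_zero, Finset.sum_const_zero]
  have h2 : (k : ℝ≥0∞) *
        ∑ e : Fin k ↪ Fin s with i ∉ Finset.univ.map e, (E * φ (fun j => S' (e j)) + Δ) =
      ∑ l : Fin s, ∑ e : Fin k ↪ Fin s with l ∈ Finset.univ.map e ∧ i ∉ Finset.univ.map e,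
        (E * φ (fun j => S' (e j)) + Δ) := by
    simp only [Finset.sum_filter]
    rw [Finset.sum_comm, Finset.mul_sum]
    refine Finset.sum_congr rfl fun e _ => ?_
    by_cases hi : i ∉ Finset.univ.map e
    · simp only [hi, not_false_eq_true, and_true, if_true]
      rw [← Finset.sum_filter, Finset.sum_const, Finset.filter_mem_eq_inter, Finset.univ_inter,
        Finset.card_map, Finset.card_univ, Fintype.card_fin, nsmul_eq_mul]
    · simp only [hi, and_false, if_false, mul_zero, Finset.sum_const_zero]
  rw [h1, h2]
  refine Finset.sum_le_sum fun l _ => ?_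
  let σ : (Fin k ↪ Fin s) ≃ (Fin k ↪ Fin s) :=
    Equiv.embeddingCongr (Equiv.refl _) (Equiv.swap i l)
  have hσ : ∀ e j, σ e j = Equiv.swap i l (e j) := fun e j => by simp [σ]
  simp only [Finset.sum_filter]
  rw [← σ.sum_comp]
  refine Finset.sum_le_sum fun e _ => ?_
  have hl : l ∈ Finset.univ.map (σ e) ↔ i ∈ Finset.univ.map e := by
    simp only [Finset.mem_map, Finset.mem_univ, true_and, hσ]
    exact exists_congr fun j => by rw [Equiv.swap_apply_eq_iff, Equiv.swap_apply_right]
  have hi : i ∈ Finset.univ.map (σ e) ↔ l ∈ Finset.univ.map e := by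
    simp only [Finset.mem_map, Finset.mem_univ, true_and, hσ]
    exact exists_congr fun j => by rw [Equiv.swap_apply_eq_iff, Equiv.swap_apply_left]
  simp only [hl, hi]
  split_ifs with hc
  · obtain ⟨⟨p, -, hp⟩, hc2⟩ := And.imp_left Finset.mem_map.1 hc
    refine hφ _ _ p fun q hq => ?_
    have h3 : e q ≠ l := fun h' => hq (e.injective (h'.trans hp.symm))
    have h4 : e q ≠ i := fun h' => hc2 (Finset.mem_map.2 ⟨q, Finset.mem_univ _, h'⟩)
    rw [hσ, Equiv.swap_apply_of_ne_of_ne h4 h3]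
    exact h _ h4
  · exact le_rfl

/-- Samples that miss `i` are the same in `S` and `S'`. Those that hit `i` form a share k/s of all
samples and are charged to the missing ones, which are at least `q` times as many; so only `E / q`
is added to the factor 1. -/
theorem sum_embedding_le {α : Type*} {k s q : ℕ} (hq : q * k ≤ s - k) {φ : (Fin k → α) → ℝ≥0∞}
    {E Δ : ℝ≥0∞} (hφ : Stable E Δ φ) {S S' : Fin s → α} {i : Fin s} (h : AgreeOff i S S') :
    (q : ℝ≥0∞) * ∑ e : Fin k ↪ Fin s, φ (fun j => S (e j)) ≤
      ((q : ℝ≥0∞) + E) * ∑ e : Fin k ↪ Fin s, φ (fun j => S' (e j)) +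
        Fintype.card (Fin k ↪ Fin s) * Δ := by
  have key : (q : ℝ≥0∞) *
        ∑ e : Fin k ↪ Fin s with i ∈ Finset.univ.map e, φ (fun j => S (e j)) ≤
      ∑ e : Fin k ↪ Fin s with i ∉ Finset.univ.map e, (E * φ (fun j => S' (e j)) + Δ) := by
    rcases Nat.eq_zero_or_pos k with h0 | hpos
    · rw [Finset.sum_eq_zero, mul_zero]
      · exact zero_le
      · intro e he
        obtain ⟨j, -, -⟩ := Finset.mem_map.1 (Finset.mem_filter.1 he).2
        exact absurd j.2 (by omega)
    · have h0 : (k : ℝ≥0∞) ≠ 0 := by exact_mod_cast hpos.ne'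
      refine (ENNReal.mul_le_mul_iff_right h0 (ENNReal.natCast_ne_top k)).1 ?_
      refine le_trans ?_ (sum_embedding_hit_le hφ h)
      rw [← mul_assoc, ← Nat.cast_mul, mul_comm k]
      gcongr
  rw [← Finset.sum_filter_add_sum_filter_not Finset.univ
    (fun e : Fin k ↪ Fin s => i ∈ Finset.univ.map e), mul_add]
  have hmiss : ∑ e : Fin k ↪ Fin s with i ∉ Finset.univ.map e, φ (fun j => S (e j)) ≤
      ∑ e : Fin k ↪ Fin s, φ (fun j => S' (e j)) := by
    refine le_trans (Finset.sum_le_sum fun e he => le_of_eq ?_)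
      (Finset.sum_le_sum_of_subset (Finset.filter_subset _ _))
    congr 1
    funext j
    refine h _ fun hj => (Finset.mem_filter.1 he).2 (Finset.mem_map.2 ⟨j, Finset.mem_univ _, hj⟩)
  have hall : ∑ e : Fin k ↪ Fin s with i ∉ Finset.univ.map e, (E * φ (fun j => S' (e j)) + Δ) ≤
      E * ∑ e : Fin k ↪ Fin s, φ (fun j => S' (e j)) + Fintype.card (Fin k ↪ Fin s) * Δ := by
    refine (Finset.sum_le_sum_of_subset (Finset.filter_subset _ _)).trans (le_of_eq ?_)
    rw [Finset.sum_add_distrib, Finset.mul_sum, Finset.sum_const, nsmul_eq_mul, Finset.card_univ]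
  calc _ ≤ (E * ∑ e : Fin k ↪ Fin s, φ (fun j => S' (e j)) +
        Fintype.card (Fin k ↪ Fin s) * Δ) +
        (q : ℝ≥0∞) * ∑ e : Fin k ↪ Fin s, φ (fun j => S' (e j)) :=
        add_le_add (key.trans hall) (mul_le_mul_right hmiss _)
    _ = _ := by ring

/-- Privacy amplification by subsampling. -/
theorem expect_subsample_le {s r : ℕ} {φ : Database X (s / r) → ℝ≥0∞} {E Δ : ℝ≥0∞}
    (hφ : Stable E Δ φ) {S S' : Database X s} {i : Fin s} (h : AgreeOff i S S') :
    ((r - 1 : ℕ) : ℝ≥0∞) * expect (subsample r S) φ ≤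
      (((r - 1 : ℕ) : ℝ≥0∞) + E) * expect (subsample r S') φ + Δ := by
  have hrk : (r - 1) * (s / r) ≤ s - s / r := by
    rw [Nat.sub_mul, one_mul]
    exact Nat.sub_le_sub_right (Nat.mul_div_le s r) (s / r)
  have hsum := sum_embedding_le hrk hφ h
  rw [expect_subsample, expect_subsample]
  have : Nonempty (Fin (s / r) ↪ Fin s) := ⟨Fin.castLEEmb (Nat.div_le_self s r)⟩
  have hc0 : (Fintype.card (Fin (s / r) ↪ Fin s) : ℝ≥0∞) ≠ 0 := by exact_mod_cast Fintype.card_ne_zero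
  calc _ = (Fintype.card (Fin (s / r) ↪ Fin s) : ℝ≥0∞)⁻¹ *
        (((r - 1 : ℕ) : ℝ≥0∞) * ∑ e : Fin (s / r) ↪ Fin s, φ (fun j => S (e j))) := by
        rw [mul_left_comm]
    _ ≤ _ := mul_le_mul_right hsum _
    _ = _ := by
        rw [mul_add, ← mul_assoc _ _ Δ, ENNReal.inv_mul_cancel hc0 (ENNReal.natCast_ne_top _),
          one_mul, mul_left_comm]

end Subsample

/-! ### Sampling with replacement -/

section Resample

variable {X : Type*}

theorem uniformOfFintype_pi (n N : ℕ) [Nonempty (Fin N)] [Nonempty (Fin n → Fin N)] :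
    PMF.uniformOfFintype (Fin n → Fin N) = iidSample (PMF.uniformOfFintype (Fin N)) n := by
  ext e
  simp [iidSample_apply, ENNReal.inv_pow]

theorem expect_iidSample_map {α β : Type*} (μ : PMF α) (g : α → β) :
    ∀ (n : ℕ) (F : (Fin n → β) → ℝ≥0∞),
      expect (iidSample (μ.map g) n) F = expect (iidSample μ n) fun x => F fun i => g (x i)
  | 0, F => by
    simp only [iidSample, expect_pure]
    congr 1
    exact Subsingleton.elim _ _
  | n + 1, F => by
    simp only [iidSample, expect_bind, expect_map, expect_iidSample_map μ g n]
    refine congrArg _ (funext fun a => congrArg _ (funext fun x => congrArg F (funext fun i => ?_)))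
    refine Fin.cases ?_ (fun j => ?_) i <;> simp

theorem expect_resample {n s : ℕ} [Nonempty (Fin s)] (h : n ≤ s) (B : Database X s)
    (φ : Database X n → ℝ≥0∞) :
    expect (resample n h B) φ =
      expect (iidSample ((PMF.uniformOfFintype (Fin s)).map B) n) φ := by
  rw [resample, expect_map, uniformOfFintype_pi, expect_iidSample_map]

/-- Hybrid argument: `ν` is replaced by `ν'` one draw at a time. With the other draws averaged out,
what remains is a function of one draw that varies by at most `E` and `Δ`, to which `hν` applies. -/
theorem expect_iidSample_le {α : Type*} {ν ν' : PMF α} {E Δ c Δ₁ : ℝ≥0∞} (hc : 1 ≤ c)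
    (hν : ∀ ψ : α → ℝ≥0∞, (∀ a b, ψ a ≤ E * ψ b + Δ) → expect ν ψ ≤ c * expect ν' ψ + Δ₁) :
    ∀ (n : ℕ) {φ : (Fin n → α) → ℝ≥0∞}, Stable E Δ φ →
      expect (iidSample ν n) φ ≤ c ^ n * expect (iidSample ν' n) φ + n * c ^ n * Δ₁
  | 0, φ, _ => by simp [iidSample]
  | n + 1, φ, hφ => by
    simp only [iidSample, expect_bind, expect_map]
    have h1 : ∀ x, Stable E Δ fun xs : Fin n → α => φ (Fin.cons x xs) := by
      intro x B B' j hj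
      refine hφ _ _ j.succ fun k => ?_
      refine Fin.cases (fun _ => by simp) (fun l hl => ?_) k
      simpa using hj l fun h => hl (by rw [h])
    have h2 : ∀ a b, (expect (iidSample ν' n) fun xs => φ (Fin.cons a xs)) ≤
        E * (expect (iidSample ν' n) fun xs => φ (Fin.cons b xs)) + Δ := by
      intro a b
      refine expect_le_mul_add _ fun xs => hφ _ _ 0 fun k => ?_
      refine Fin.cases (fun h => absurd rfl h) (fun l _ => by simp) k
    calc _ ≤ expect ν fun x => c ^ n * (expect (iidSample ν' n) fun xs => φ (Fin.cons x xs)) +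
          n * c ^ n * Δ₁ := expect_mono _ fun x => expect_iidSample_le hc hν n (h1 x)
      _ = c ^ n * (expect ν fun x => expect (iidSample ν' n) fun xs => φ (Fin.cons x xs)) +
          n * c ^ n * Δ₁ := by rw [expect_add, expect_const_mul, expect_const]
      _ ≤ c ^ n * (c * (expect ν' fun x => expect (iidSample ν' n) fun xs => φ (Fin.cons x xs)) +
          Δ₁) + n * c ^ n * Δ₁ := by gcongr; exact hν _ h2
      _ = c ^ (n + 1) * (expect ν' fun x => expect (iidSample ν' n) fun xs => φ (Fin.cons x xs)) +
          (n + 1) * c ^ n * Δ₁ := by ring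
      _ ≤ _ := by
          push_cast
          gcongr ?_ + _ * ?_ * _
          · exact le_rfl
          · exact pow_le_pow_right₀ hc (Nat.le_succ n)

/-- The changed entry is drawn with probability 1/N, and its value is at most `E` times the average
over `B'`, plus `Δ`. -/
theorem expect_uniform_map_le {α : Type*} {N : ℕ} [Nonempty (Fin N)] {B B' : Fin N → α} {j : Fin N}
    (h : AgreeOff j B B') {E Δ : ℝ≥0∞} {ψ : α → ℝ≥0∞} (hψ : ∀ a b, ψ a ≤ E * ψ b + Δ) :
    expect ((PMF.uniformOfFintype (Fin N)).map B) ψ ≤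
      (1 + E / N) * expect ((PMF.uniformOfFintype (Fin N)).map B') ψ + Δ / N := by
  have hN : (N : ℝ≥0∞) ≠ 0 := by
    have := j.pos
    exact_mod_cast this.ne'
  set M := expect ((PMF.uniformOfFintype (Fin N)).map B') ψ with hM
  have h1 : ψ (B j) ≤ E * M + Δ := by
    rw [← expect_const ((PMF.uniformOfFintype (Fin N)).map B') (ψ (B j))]
    exact expect_le_mul_add _ fun b => hψ _ b
  have h2 : ∑ i, ψ (B i) ≤ (∑ i, ψ (B' i)) + (E * M + Δ) := by
    rw [← Finset.sum_erase_add _ _ (Finset.mem_univ j)]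
    refine add_le_add ?_ h1
    calc _ = ∑ i ∈ Finset.univ.erase j, ψ (B' i) :=
          Finset.sum_congr rfl fun i hi => by rw [h i (Finset.ne_of_mem_erase hi)]
      _ ≤ _ := Finset.sum_le_sum_of_subset (Finset.erase_subset _ _)
  have hM' : M = (N : ℝ≥0∞)⁻¹ * ∑ i, ψ (B' i) := by
    rw [hM, expect_map, expect_uniformOfFintype, Fintype.card_fin]
  rw [expect_map, expect_uniformOfFintype, Fintype.card_fin]
  calc _ ≤ (N : ℝ≥0∞)⁻¹ * ((∑ i, ψ (B' i)) + (E * M + Δ)) := mul_le_mul_right h2 _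
    _ = M + (N : ℝ≥0∞)⁻¹ * (E * M + Δ) := by rw [mul_add, ← hM']
    _ = _ := by simp only [div_eq_mul_inv]; ring

/-- The power is at most exp(e n/N) ≤ e^3 < 21. -/
theorem one_add_exp_div_pow_le {n N : ℕ} (hN : 0 < N) (h : n ≤ N) :
    (1 + ENNReal.ofReal (Real.exp 1) / N) ^ n ≤ 21 := by
  have hN' : (0 : ℝ) < N := by exact_mod_cast hN
  have h1 : 1 + ENNReal.ofReal (Real.exp 1) / N = ENNReal.ofReal (1 + Real.exp 1 / N) := by
    rw [ENNReal.ofReal_add zero_le_one (by positivity), ENNReal.ofReal_one,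
      ENNReal.ofReal_div_of_pos hN', ENNReal.ofReal_natCast]
  have h21 : (21 : ℝ≥0∞) = ENNReal.ofReal 21 := by simp
  rw [h1, ← ENNReal.ofReal_pow (by positivity), h21]
  refine ENNReal.ofReal_le_ofReal ?_
  have he : Real.exp 1 < 2.7182818286 := Real.exp_one_lt_d9
  calc (1 + Real.exp 1 / N) ^ n ≤ (Real.exp (Real.exp 1 / N)) ^ n := by
        gcongr
        rw [add_comm]
        exact Real.add_one_le_exp _
    _ = Real.exp (n * (Real.exp 1 / N)) := (Real.exp_nat_mul _ n).symm
    _ ≤ Real.exp 3 := by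
        gcongr
        have h2 : (n : ℝ) / N ≤ 1 := (div_le_one hN').2 (by exact_mod_cast h)
        have h3 : (n : ℝ) * (Real.exp 1 / N) = n / N * Real.exp 1 := by ring
        rw [h3]
        nlinarith [Real.exp_pos 1]
    _ = Real.exp 1 ^ 3 := by rw [← Real.exp_nat_mul]; norm_num
    _ ≤ 2.7182818286 ^ 3 := by gcongr
    _ ≤ 21 := by norm_num

/-- Privacy of sampling with replacement. -/
theorem expect_resample_stable {n N : ℕ} (h : n ≤ N) {φ : Database X n → ℝ≥0∞} {Δ : ℝ≥0∞}
    (hφ : Stable (ENNReal.ofReal (Real.exp 1)) Δ φ) :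
    Stable 21 (21 * Δ) fun B => expect (resample n h B) φ := by
  intro B B' j hB
  have : Nonempty (Fin N) := ⟨j⟩
  have hN := j.pos
  have hpow := one_add_exp_div_pow_le hN h
  simp only [expect_resample]
  refine (expect_iidSample_le (le_self_add) (fun ψ hψ => expect_uniform_map_le hB hψ) n hφ).trans ?_
  refine add_le_add (mul_le_mul_left hpow _) ?_
  calc _ = (n / N) * ((1 + ENNReal.ofReal (Real.exp 1) / N) ^ n) * Δ := by
        generalize (1 + ENNReal.ofReal (Real.exp 1) / N) ^ n = c
        simp only [div_eq_mul_inv]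
        ring
    _ ≤ 1 * 21 * Δ := by
        gcongr
        exact ENNReal.div_le_of_le_mul (by rw [one_mul]; exact_mod_cast h)
    _ = _ := by rw [one_mul]

end Resample

/-! ### The exponential mechanism on representatives -/

section Hypotheses

variable {X : Type*} {C : Set (Concept X)} {P : Set X} [Finite P]

theorem mem_of_mem_hypotheses {h : Concept X} (hh : h ∈ hypotheses C P) : h ∈ C := by
  simp only [hypotheses, Set.Finite.mem_toFinset, Set.mem_range] at hh
  obtain ⟨z, rfl⟩ := hh
  exact (Classical.choose_spec z.2).1

theorem exists_mem_hypotheses {c : Concept X} (hc : c ∈ C) :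
    ∃ h ∈ hypotheses C P, ∀ x ∈ P, h x = c x := by
  refine ⟨representative C P ⟨_, c, hc, rfl⟩, by simp [hypotheses], fun x hx => ?_⟩
  exact congrFun (Classical.choose_spec (⟨_, c, hc, rfl⟩ : projection C P).2).2 ⟨x, hx⟩

theorem eq_of_mem_hypotheses {h h' : Concept X} (hh : h ∈ hypotheses C P)
    (hh' : h' ∈ hypotheses C P) (heq : ∀ x ∈ P, h x = h' x) : h = h' := by
  simp only [hypotheses, Set.Finite.mem_toFinset, Set.mem_range] at hh hh'
  obtain ⟨z, rfl⟩ := hh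
  obtain ⟨z', rfl⟩ := hh'
  congr 1
  refine Subtype.ext ?_
  rw [← (Classical.choose_spec z.2).2, ← (Classical.choose_spec z'.2).2]
  exact funext fun p => heq p p.2

end Hypotheses

/-! ### Privacy of a relabelling whose solution set depends on the data -/

section Mechanism

variable {X : Type*}

theorem expWeight_of_mem {s : ℕ} {ε : ℝ} {H : Finset (Concept X)} {S : Database X s}
    {h : Concept X} (hh : h ∈ H) :
    expWeight ε H S h = ENNReal.ofReal (Real.exp (ε * score S h / 2)) := by
  simp [expWeight, hh]

theorem tsum_expWeight {s : ℕ} (ε : ℝ) (H : Finset (Concept X)) (S : Database X s) :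
    ∑' h, expWeight ε H S h = ∑ h ∈ H, expWeight ε H S h :=
  tsum_eq_sum fun h hh => by simp [expWeight, hh]

theorem expect_expMechanism {s : ℕ} (ε : ℝ) {H : Finset (Concept X)} (hH : H.Nonempty)
    (S : Database X s) (g : Concept X → ℝ≥0∞) :
    expect (expMechanism ε H hH S) g =
      (∑ h ∈ H, expWeight ε H S h * g h) * (∑ h ∈ H, expWeight ε H S h)⁻¹ := by
  rw [expect, Finset.sum_mul, tsum_eq_sum (s := H)]
  · refine Finset.sum_congr rfl fun h _ => ?_
    rw [expMechanism, PMF.normalize_apply, tsum_expWeight, mul_right_comm]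
  · intro h hh
    simp [expMechanism, PMF.normalize_apply, expWeight, hh]

/-- Stated for arbitrary `g` and `G` so that it serves both the numerator and, with the constant 1
and the databases exchanged, the normalizing constant. The factor 2 is the multiplicity of the
correspondence between the solution sets; the factor exp(1/2) is a change of the score by 1. -/
theorem sum_expWeight_mul_le {C : Set (Concept X)} {N s : ℕ} {B B' : Database X N} {j : Fin N}
    (hB : AgreeOff j B B') {S S' : Database X s}
    (hq : ∀ h h' : Concept X, (∀ k, k ≠ j → h (B k).1 = h' (B k).1) →
      score S h ≤ score S' h' + 1) {g G : Concept X → ℝ≥0∞}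
    (hg : ∀ h h' : Concept X, (∀ k, k ≠ j → h (B k).1 = h' (B k).1) → g h ≤ G h') :
    ∑ h ∈ hypotheses C (points B), expWeight 1 (hypotheses C (points B)) S h * g h ≤
      2 * ENNReal.ofReal (Real.exp (1 / 2)) *
        ∑ h ∈ hypotheses C (points B'), expWeight 1 (hypotheses C (points B')) S' h * G h := by
  classical
  have hex : ∀ h : Concept X, ∃ h' : Concept X, h ∈ hypotheses C (points B) →
      h' ∈ hypotheses C (points B') ∧ ∀ k, k ≠ j → h (B k).1 = h' (B k).1 := by
    intro h
    by_cases hh : h ∈ hypotheses C (points B)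
    · obtain ⟨h', h1, h2⟩ := exists_mem_hypotheses (P := points B') (mem_of_mem_hypotheses hh)
      refine ⟨h', fun _ => ⟨h1, fun k hk => ?_⟩⟩
      rw [hB k hk]
      exact (h2 _ ⟨k, rfl⟩).symm
    · exact ⟨h, fun h1 => absurd h1 hh⟩
  choose f hf using hex
  set c := ENNReal.ofReal (Real.exp (1 / 2)) with hc
  have h1 : ∀ h ∈ hypotheses C (points B), expWeight 1 (hypotheses C (points B)) S h * g h ≤
      c * (expWeight 1 (hypotheses C (points B')) S' (f h) * G (f h)) := by
    intro h hh
    rw [← mul_assoc]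
    refine mul_le_mul' ?_ (hg _ _ (hf h hh).2)
    rw [expWeight_of_mem hh, expWeight_of_mem (hf h hh).1, hc,
      ← ENNReal.ofReal_mul (Real.exp_pos _).le, ← Real.exp_add]
    refine ENNReal.ofReal_le_ofReal (Real.exp_le_exp.2 ?_)
    have := hq _ _ (hf h hh).2
    have h2 : (score S h : ℝ) ≤ score S' (f h) + 1 := by exact_mod_cast this
    linarith
  refine (Finset.sum_le_sum h1).trans ?_
  rw [← Finset.sum_fiberwise_of_maps_to fun h hh => (hf h hh).1, Finset.mul_sum]
  refine Finset.sum_le_sum fun h' _ => ?_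
  -- Concepts with the same image agree at all entries other than `j`, so only the value at entry
  -- `j` can separate them, and a member of the solution set is determined by its values on the
  -- points.
  have hfib : ((hypotheses C (points B)).filter fun h => f h = h').card ≤ 2 := by
    refine (Finset.card_le_card_of_injOn (t := (Finset.univ : Finset Bool))
      (fun h => h (B j).1) (fun _ _ => Finset.mem_coe.2 (Finset.mem_univ _)) ?_).trans_eq rfl
    intro a ha b hb hab
    rw [Finset.mem_coe, Finset.mem_filter] at ha hb
    refine eq_of_mem_hypotheses ha.1 hb.1 ?_
    rintro _ ⟨k, rfl⟩
    by_cases hk : k = j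
    · rw [hk]
      exact hab
    · rw [(hf a ha.1).2 k hk, (hf b hb.1).2 k hk, ha.2, hb.2]
  calc _ = ∑ h ∈ (hypotheses C (points B)).filter (fun h => f h = h'),
        c * (expWeight 1 (hypotheses C (points B')) S' h' * G h') :=
        Finset.sum_congr rfl fun h hh => by rw [(Finset.mem_filter.1 hh).2]
    _ = ((hypotheses C (points B)).filter fun h => f h = h').card *
        (c * (expWeight 1 (hypotheses C (points B')) S' h' * G h')) := by
        rw [Finset.sum_const, nsmul_eq_mul]
    _ ≤ (2 : ℕ) * (c * (expWeight 1 (hypotheses C (points B')) S' h' * G h')) := by gcongr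
    _ = _ := by push_cast; ring

theorem two_mul_exp_half_sq :
    (2 * ENNReal.ofReal (Real.exp (1 / 2))) * (2 * ENNReal.ofReal (Real.exp (1 / 2))) ≤ 11 := by
  have h1 : ENNReal.ofReal (Real.exp (1 / 2)) * ENNReal.ofReal (Real.exp (1 / 2)) =
      ENNReal.ofReal (Real.exp 1) := by
    rw [← ENNReal.ofReal_mul (Real.exp_pos _).le, ← Real.exp_add]
    norm_num
  calc _ = 4 * (ENNReal.ofReal (Real.exp (1 / 2)) * ENNReal.ofReal (Real.exp (1 / 2))) := by ring
    _ = ENNReal.ofReal (4 * Real.exp 1) := by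
      rw [h1, ENNReal.ofReal_mul (by norm_num)]
      simp
    _ ≤ ENNReal.ofReal 11 :=
      ENNReal.ofReal_le_ofReal (by linarith [Real.exp_one_lt_d9])
    _ = 11 := by simp

theorem expect_expMechanism_le {C : Set (Concept X)} (hC : C.Nonempty) {N s : ℕ}
    {B B' : Database X N} {j : Fin N} (hB : AgreeOff j B B') {S S' : Database X s}
    (hq : ∀ h h' : Concept X, (∀ k, k ≠ j → h (B k).1 = h' (B k).1) →
      score S h ≤ score S' h' + 1 ∧ score S' h' ≤ score S h + 1) {g g' : Concept X → ℝ≥0∞}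
    {E Δ : ℝ≥0∞}
    (hg : ∀ h h' : Concept X, (∀ k, k ≠ j → h (B k).1 = h' (B k).1) → g h ≤ E * g' h' + Δ) :
    expect (expMechanism 1 (hypotheses C (points B)) (hypotheses_nonempty hC _) S) g ≤
      11 * (E * expect (expMechanism 1 (hypotheses C (points B')) (hypotheses_nonempty hC _) S') g'
        + Δ) := by
  have h1 := sum_expWeight_mul_le (C := C) hB (fun h h' hh => (hq h h' hh).1) hg
  have h2 := sum_expWeight_mul_le (C := C) (S := S') (S' := S) hB.symm (g := fun _ => 1)
    (G := fun _ => 1) (fun h h' hh => (hq h' h fun k hk => by rw [hB k hk, hh k hk]).2)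
    (fun _ _ _ => le_rfl)
  simp only [mul_one] at h2
  set κ := 2 * ENNReal.ofReal (Real.exp (1 / 2)) with hκ
  have hκ0 : κ ≠ 0 := by simp [hκ, Real.exp_pos]
  have hκt : κ ≠ ∞ := ENNReal.mul_ne_top (by simp) (by simp)
  set W := ∑ h ∈ hypotheses C (points B), expWeight 1 (hypotheses C (points B)) S h
  set W' := ∑ h ∈ hypotheses C (points B'), expWeight 1 (hypotheses C (points B')) S' h with hW'
  have h3 : W⁻¹ ≤ κ * W'⁻¹ := by
    have h4 : (κ * W)⁻¹ ≤ W'⁻¹ := ENNReal.inv_le_inv.2 h2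
    rw [ENNReal.mul_inv (Or.inl hκ0) (Or.inl hκt)] at h4
    calc W⁻¹ = κ * (κ⁻¹ * W⁻¹) := by
          rw [← mul_assoc, ENNReal.mul_inv_cancel hκ0 hκt, one_mul]
      _ ≤ _ := mul_le_mul_right h4 _
  have h5 : expect (expMechanism 1 (hypotheses C (points B')) (hypotheses_nonempty hC _) S')
      (fun h => E * g' h + Δ) = E * expect (expMechanism 1 (hypotheses C (points B'))
        (hypotheses_nonempty hC _) S') g' + Δ := by
    rw [expect_add, expect_const_mul, expect_const]
  rw [← h5, expect_expMechanism, expect_expMechanism]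
  calc _ ≤ (κ * ∑ h ∈ hypotheses C (points B'),
          expWeight 1 (hypotheses C (points B')) S' h * (E * g' h + Δ)) * (κ * W'⁻¹) :=
        mul_le_mul' h1 h3
    _ = κ * κ * ((∑ h ∈ hypotheses C (points B'),
          expWeight 1 (hypotheses C (points B')) S' h * (E * g' h + Δ)) * W'⁻¹) := by ring
    _ ≤ _ := mul_le_mul_left two_mul_exp_half_sq _

theorem score_le_succ {s : ℕ} {S S' : Database X s} {j : Fin s} (hS : AgreeOff j S S')
    {h h' : Concept X} (hh : ∀ k, k ≠ j → h (S k).1 = h' (S k).1) :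
    score S h ≤ score S' h' + 1 := by
  classical
  refine (Finset.card_le_card (t := insert j
    (Finset.univ.filter fun i => (S' i).2 = some (h' (S' i).1))) fun i hi => ?_).trans
    (Finset.card_insert_le _ _)
  by_cases hij : i = j
  · exact Finset.mem_insert.2 (Or.inl hij)
  · refine Finset.mem_insert_of_mem (Finset.mem_filter.2 ⟨Finset.mem_univ _, ?_⟩)
    rw [← hS i hij, ← hh i hij]
    exact (Finset.mem_filter.1 hi).2

theorem score_congr {s : ℕ} {S : Database X s} {h h' : Concept X}
    (hh : ∀ k, h (S k).1 = h' (S k).1) : score S h = score S h' := by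
  simp only [score, hh]

theorem relabel_agreeOff {N : ℕ} {B B' : Database X N} {j : Fin N} (hB : AgreeOff j B B')
    {h h' : Concept X} (hh : ∀ k, k ≠ j → h (B k).1 = h' (B k).1) :
    AgreeOff j (relabel h B) (relabel h' B') := fun k hk => by
  simp only [relabel, ← hB k hk, hh k hk]

theorem expect_labelBoostProcedure {C : Set (Concept X)} (hC : C.Nonempty) {s t : ℕ}
    (S : Database X s) (T : Database X t) (φ : Database X (s + t) → ℝ≥0∞) :
    expect (labelBoostProcedure C hC S T) φ =
      expect (expMechanism 1 (hypotheses C (points (Fin.append S T))) (hypotheses_nonempty hC _) S)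
        fun h => φ (relabel h (Fin.append S T)) :=
  expect_map _ _ _

theorem append_agreeOff_left {α : Type*} {s t : ℕ} {S S' : Fin s → α} {j : Fin s}
    (hS : AgreeOff j S S') (T : Fin t → α) :
    AgreeOff (Fin.castAdd t j) (Fin.append S T) (Fin.append S' T) := fun k hk => by
  refine Fin.addCases (fun i hi => ?_) (fun i _ => by simp) k hk
  simpa using hS i fun h => hi (by rw [h])

theorem append_agreeOff_right {α : Type*} {s t : ℕ} (S : Fin s → α) {T T' : Fin t → α} {j : Fin t}
    (hT : AgreeOff j T T') :
    AgreeOff (Fin.natAdd s j) (Fin.append S T) (Fin.append S T') := fun k hk => by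
  refine Fin.addCases (fun i _ => by simp) (fun i hi => ?_) k hk
  simpa using hT i fun h => hi (by rw [h])

theorem labelBoostProcedure_stable_left {C : Set (Concept X)} (hC : C.Nonempty) {s t : ℕ}
    (T : Database X t) {φ : Database X (s + t) → ℝ≥0∞} {E Δ : ℝ≥0∞} (hφ : Stable E Δ φ) :
    Stable (11 * E) (11 * Δ) fun S => expect (labelBoostProcedure C hC S T) φ := by
  intro S S' j hS
  have hB := append_agreeOff_left hS T
  simp only [expect_labelBoostProcedure]
  rw [mul_assoc, ← mul_add]
  refine expect_expMechanism_le hC hB (fun h h' hh => ?_) fun h h' hh =>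
    hφ _ _ _ (relabel_agreeOff hB hh)
  have hh' : ∀ k, k ≠ j → h (S k).1 = h' (S k).1 := fun k hk => by
    have := hh (Fin.castAdd t k) fun he => hk (Fin.castAdd_injective _ _ he)
    simpa using this
  refine ⟨score_le_succ hS hh', score_le_succ hS.symm fun k hk => ?_⟩
  rw [← hS k hk, hh' k hk]

theorem labelBoostProcedure_stable_right {C : Set (Concept X)} (hC : C.Nonempty) {s t : ℕ}
    (S : Database X s) {φ : Database X (s + t) → ℝ≥0∞} {E Δ : ℝ≥0∞} (hφ : Stable E Δ φ) :
    Stable (11 * E) (11 * Δ) fun T : Database X t => expect (labelBoostProcedure C hC S T) φ := by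
  intro T T' j hT
  have hB := append_agreeOff_right S hT
  simp only [expect_labelBoostProcedure]
  rw [mul_assoc, ← mul_add]
  refine expect_expMechanism_le hC hB (fun h h' hh => ?_) fun h h' hh =>
    hφ _ _ _ (relabel_agreeOff hB hh)
  have hh' : ∀ k, h (S k).1 = h' (S k).1 := fun k => by
    have := hh (Fin.castAdd t k) fun he => by
      have := congrArg Fin.val he
      simp only [Fin.val_natAdd, Fin.val_castAdd] at this
      omega
    simpa using this
  rw [score_congr hh']
  exact ⟨Nat.le_succ _, Nat.le_succ _⟩

end Mechanism

/-! ### Privacy of `LabelBoost` -/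

section Privacy

variable {X : Type*}

theorem one_le_ofReal_exp_one : 1 ≤ ENNReal.ofReal (Real.exp 1) := by
  rw [← ENNReal.ofReal_one]
  exact ENNReal.ofReal_le_ofReal (Real.one_le_exp zero_le_one)

theorem two_le_ofReal_exp_one : 2 ≤ ENNReal.ofReal (Real.exp 1) := by
  have h : (2 : ℝ≥0∞) = ENNReal.ofReal 2 := by simp
  rw [h]
  exact ENNReal.ofReal_le_ofReal (by linarith [Real.exp_one_gt_d9])

theorem ofReal_exp_one_le_three : ENNReal.ofReal (Real.exp 1) ≤ 3 := by
  have h : (3 : ℝ≥0∞) = ENNReal.ofReal 3 := by simp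
  rw [h]
  exact ENNReal.ofReal_le_ofReal (by linarith [Real.exp_one_lt_d9])

theorem le_exp_one_mul_add (a Δ : ℝ≥0∞) : a ≤ ENNReal.ofReal (Real.exp 1) * a + Δ :=
  le_add_right (le_mul_of_one_le_left zero_le one_le_ofReal_exp_one)

/-- Common end of all amplification steps: the factor 1 + E/q is at most 2, which is below e, and
the summand is at most Δ. -/
theorem le_of_amplified {q : ℕ} (hq : q ≠ 0) {E c a b Δ : ℝ≥0∞} (hE : E ≤ q) (hc : c ≤ q)
    (h : (q : ℝ≥0∞) * a ≤ (q + E) * b + c * Δ) :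
    a ≤ ENNReal.ofReal (Real.exp 1) * b + Δ := by
  have h0 : (q : ℝ≥0∞) ≠ 0 := by exact_mod_cast hq
  refine (ENNReal.mul_le_mul_iff_right h0 (ENNReal.natCast_ne_top q)).1 (h.trans ?_)
  calc (q + E) * b + c * Δ ≤ (q + q) * b + q * Δ := by gcongr
    _ = q * (2 * b + Δ) := by ring
    _ ≤ _ := by
      gcongr
      exact two_le_ofReal_exp_one

theorem IsDP.stable {n : ℕ} {δ : ℝ} {A : Learner X n} (hA : IsDP 1 δ A) (F : Set (Concept X)) :
    Stable (ENNReal.ofReal (Real.exp 1)) (ENNReal.ofReal δ) fun B => (A B).toOuterMeasure F := by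
  intro B B' j h
  by_cases hj : B j = B' j
  · have : B = B' := by
      funext k
      by_cases hk : k = j
      · rw [hk, hj]
      · exact h k hk
    rw [this]
    exact le_exp_one_mul_add _ _
  · exact hA B B' ⟨j, hj, h⟩ F

theorem finalStep_stable {n s : ℕ} {δ : ℝ} {A : Learner X n} (hA : IsDP 1 δ A) (h : 300 * n ≤ s)
    (F : Set (Concept X)) :
    Stable (ENNReal.ofReal (Real.exp 1)) (ENNReal.ofReal δ)
      fun S => (finalStep A S h).toOuterMeasure F := by
  intro S S' j hS
  simp only [finalStep, toOuterMeasure_bind]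
  have h1 := expect_subsample_le (r := 300) (expect_resample_stable
    ((Nat.le_div_iff_mul_le (by norm_num)).2 (by omega)) (hA.stable F)) hS
  refine le_of_amplified (q := 299) (by norm_num) ?_ ?_ h1 <;> norm_num

/-- Induction on the fuel with the same constants e and δ at every level. The changed entry sits in
exactly one of `S` and `D`; all sizes are the same in both runs, so they make the same branching
decisions. -/
theorem labelBoostLoop_stable {n : ℕ} (α β : ℝ) {δ : ℝ} {C : Set (Concept X)} (hC : C.Nonempty)
    {A : Learner X n} (hA : IsDP 1 δ A) (F : Set (Concept X)) :
    ∀ (fuel i : ℕ) {s u : ℕ} {S S' : Database X s} {D D' : Database X u},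
      ((∃ j, AgreeOff j S S') ∧ D = D' ∨ S = S' ∧ ∃ j, AgreeOff j D D') →
      (labelBoostLoop α β C hC A fuel i S D).toOuterMeasure F ≤
        ENNReal.ofReal (Real.exp 1) * (labelBoostLoop α β C hC A fuel i S' D').toOuterMeasure F +
          ENNReal.ofReal δ
  | 0, _, _, _, _, _, _, _, _ => by
    simp only [labelBoostLoop]
    exact le_exp_one_mul_add _ _
  | fuel + 1, i, s, u, S, S', D, D', hSD => by
    have ih := fun {s u : ℕ} {S S' : Database X s} {D D' : Database X u} h =>
      labelBoostLoop_stable α β hC hA F fuel (i + 1) (s := s) (u := u) (S := S) (S' := S')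
        (D := D) (D' := D') h
    simp only [labelBoostLoop]
    split_ifs with hs hv
    · rcases hSD with ⟨⟨j, hj⟩, -⟩ | ⟨rfl, -⟩
      · exact finalStep_stable hA hs F _ _ j hj
      · exact le_exp_one_mul_add _ _
    · simp only [toOuterMeasure_bind]
      have hE : 11 * ENNReal.ofReal (Real.exp 1) ≤ (99 : ℕ) := by
        calc _ ≤ 11 * (3 : ℝ≥0∞) := mul_le_mul_right ofReal_exp_one_le_three _
          _ ≤ _ := by norm_num
      have h11 : (11 : ℝ≥0∞) ≤ (99 : ℕ) := by norm_num
      rcases hSD with ⟨⟨j, hj⟩, rfl⟩ | ⟨rfl, j, hj⟩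
      · refine le_of_amplified (q := 99) (by norm_num) hE h11
          (expect_subsample_le (r := 100) (fun S₁ S₁' l hl => ?_) hj)
        exact expect_le_mul_add _ fun T₁ => labelBoostProcedure_stable_left hC T₁
          (fun B B' k hk => ih (Or.inl ⟨⟨k, hk⟩, rfl⟩)) S₁ S₁' l hl
      -- A changed entry of `D` either enters `T` now, where it is subsampled and relabelled, or is
      -- passed on untouched to the next iteration.
      · by_cases hjv : (j : ℕ) < stretchSize α β (vcDim C).toNat n i s
        · have hD : (fun k : Fin (u - stretchSize α β (vcDim C).toNat n i s) =>
              D ⟨stretchSize α β (vcDim C).toNat n i s + k, by omega⟩) =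
              fun k : Fin (u - stretchSize α β (vcDim C).toNat n i s) => D' ⟨stretchSize α β (vcDim C).toNat n i s + k, by omega⟩ := by
            funext k
            exact hj _ fun h => by
              have := congrArg Fin.val h
              simp only at this
              omega
          rw [hD]
          have hT : AgreeOff (⟨j, hjv⟩ : Fin (stretchSize α β (vcDim C).toNat n i s))
              (fun k => D (Fin.castLE hv k)) (fun k => D' (Fin.castLE hv k)) := by
            intro k hk
            exact hj _ fun h => hk (Fin.ext (show (k : ℕ) = j from congrArg Fin.val h))
          refine expect_le_mul_add _ fun S₁ => ?_
          exact le_of_amplified (q := 99) (by norm_num) hE h11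
            (expect_subsample_le (r := 100) (labelBoostProcedure_stable_right hC S₁
              (fun B B' k hk => ih (Or.inl ⟨⟨k, hk⟩, rfl⟩))) hT)
        · have hT : (fun k : Fin (stretchSize α β (vcDim C).toNat n i s) =>
              D (Fin.castLE hv k)) = fun k => D' (Fin.castLE hv k) := by
            funext k
            exact hj _ fun h => hjv (h ▸ k.2)
          rw [hT]
          refine expect_le_mul_add _ fun S₁ => expect_le_mul_add _ fun T₁ =>
            expect_le_mul_add _ fun S₂ => ih (Or.inr ⟨rfl,
              ⟨j - stretchSize α β (vcDim C).toNat n i s, by omega⟩, fun k hk => hj _ fun h => ?_⟩)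
          have := congrArg Fin.val h
          simp only at this
          exact hk (Fin.ext (by simp only; omega))
    · exact le_exp_one_mul_add _ _

theorem labelBoost_isDP {n : ℕ} (α β : ℝ) {δ δ' : ℝ} (hδ : δ ≤ δ') {C : Set (Concept X)}
    (hC : C.Nonempty) {A : Learner X n} (hA : IsDP 1 δ A) (m : ℕ) :
    IsDP 1 δ' (labelBoost α β C hC A m) := by
  rintro B B' ⟨j, -, hj⟩ F
  refine (labelBoostLoop_stable α β hC hA F _ _ ?_).trans
    (add_le_add_right (ENNReal.ofReal_le_ofReal hδ) _)
  refine Fin.addCases (motive := fun j => (∀ k, k ≠ j → B k = B' k) → _) (fun l hl => ?_)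
    (fun l hl => ?_) j hj
  · refine Or.inl ⟨⟨l, fun k hk => hl _ fun h => hk (Fin.castAdd_injective _ _ h)⟩, ?_⟩
    funext k
    exact hl _ fun h => by
      have := congrArg Fin.val h
      simp only [Fin.val_natAdd, Fin.val_castAdd] at this
      omega
  · refine Or.inr ⟨?_, l, fun k hk => hl _ fun h => hk (Fin.natAdd_injective _ _ h)⟩
    funext k
    exact hl _ fun h => by
      have := congrArg Fin.val h
      simp only [Fin.val_natAdd, Fin.val_castAdd] at this
      omega

end Privacy

/-! ### Traces of a class and the Sauer–Shelah bound -/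

section Traces

variable {X κ ι : Type*} [Fintype κ] [Fintype ι]

open Classical in
/-- The restrictions of the members of `C` to the tuple `y`. -/
def traces (C : Set (Concept X)) (y : κ → X) : Finset (κ → Bool) :=
  Finset.univ.filter fun t => ∃ g ∈ C, t = fun k => g (y k)

theorem mem_traces {C : Set (Concept X)} {y : κ → X} {t : κ → Bool} :
    t ∈ traces C y ↔ ∃ g ∈ C, t = fun k => g (y k) := by
  simp [traces]

theorem trace_mem_traces {C : Set (Concept X)} {g : Concept X} (hg : g ∈ C) (y : κ → X) :
    (fun k => g (y k)) ∈ traces C y :=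
  mem_traces.2 ⟨g, hg, rfl⟩

theorem traces_mono {C C' : Set (Concept X)} (h : C ⊆ C') (y : κ → X) :
    traces C y ⊆ traces C' y := fun _ ht =>
  let ⟨g, hg, e⟩ := mem_traces.1 ht
  mem_traces.2 ⟨g, h hg, e⟩

theorem Shatters.card_le_of_vcDim_le {C : Set (Concept X)} {d : ℕ} (hd : vcDim C ≤ d) {B : Finset X}
    (hB : Shatters C B) : B.card ≤ d := by
  have h1 : (B.card : ℕ∞) ≤ vcDim C := le_iSup₂ (f := fun (B : Finset X) (_ : Shatters C B) =>
    (B.card : ℕ∞)) B hB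
  exact_mod_cast h1.trans hd

/-- The **Sauer–Shelah lemma** for tuples. -/
theorem card_traces_le_sum {C : Set (Concept X)} {d : ℕ} (hd : vcDim C ≤ d) (y : κ → X) :
    (traces C y).card ≤ ∑ k ∈ Finset.range (d + 1), (Fintype.card κ).choose k := by
  classical
  let F : (κ → Bool) → Finset κ := fun t => Finset.univ.filter fun k => t k = true
  have hF : Function.Injective F := by
    intro t t' h
    funext k
    have := Finset.ext_iff.1 h k
    simp only [F, Finset.mem_filter, Finset.mem_univ, true_and] at this
    exact Bool.eq_iff_iff.2 this
  set 𝒜 := (traces C y).image F with h𝒜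
  have hvc : 𝒜.vcDim ≤ d := by
    refine Finset.sup_le fun s hs => ?_
    rw [Finset.mem_shatterer] at hs
    -- Two indices that carry the same point always receive the same label, so no shattered index
    -- set contains both.
    have hinj : Set.InjOn y s := by
      intro k hk l hl hkl
      obtain ⟨u, hu, hsu⟩ := hs.exists_inter_eq_singleton hk
      obtain ⟨t, ht, rfl⟩ := Finset.mem_image.1 hu
      obtain ⟨c, -, rfl⟩ := mem_traces.1 ht
      have hk' : k ∈ s ∩ F fun k => c (y k) := by simp [hsu]
      have hl' : l ∈ s ∩ F fun k => c (y k) := by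
        simp only [Finset.mem_inter, F, Finset.mem_filter, Finset.mem_univ, true_and] at hk' ⊢
        exact ⟨hl, hkl ▸ hk'.2⟩
      rw [hsu, Finset.mem_singleton] at hl'
      exact hl'.symm
    rw [← Finset.card_image_of_injOn hinj]
    refine Shatters.card_le_of_vcDim_le hd fun f => ?_
    obtain ⟨u, hu, hsu⟩ := hs (t := s.filter fun k => f (y k) = true) (Finset.filter_subset _ _)
    obtain ⟨t, ht, rfl⟩ := Finset.mem_image.1 hu
    obtain ⟨c, hc, rfl⟩ := mem_traces.1 ht
    refine ⟨c, hc, fun x hx => ?_⟩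
    obtain ⟨k, hk, rfl⟩ := Finset.mem_image.1 hx
    have := Finset.ext_iff.1 hsu k
    simp only [F, Finset.mem_inter, Finset.mem_filter, Finset.mem_univ, hk, true_and] at this
    exact Bool.eq_iff_iff.2 this
  calc (traces C y).card = 𝒜.card := (Finset.card_image_of_injective _ hF).symm
    _ ≤ 𝒜.shatterer.card := Finset.card_le_card_shatterer 𝒜
    _ ≤ ∑ k ∈ Finset.Iic 𝒜.vcDim, (Fintype.card κ).choose k :=
        Finset.card_shatterer_le_sum_vcDim
    _ ≤ _ := Finset.sum_le_sum_of_subset fun k hk =>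
        Finset.mem_range.2 (Nat.lt_succ_of_le ((Finset.mem_Iic.1 hk).trans hvc))

/-- Since θ ≤ 1, each term with k ≤ d satisfies θ^d ≤ θ^k, and the binomial theorem bounds the sum
by (1 + θ)^N. The parameter θ stays free because it is tuned differently in each application. -/
theorem sum_choose_le {θ : ℝ} (h0 : 0 < θ) (h1 : θ ≤ 1) (d N : ℕ) :
    (∑ k ∈ Finset.range (d + 1), N.choose k : ℝ) ≤ (1 / θ) ^ d * Real.exp (θ * N) := by
  have h2 : θ ^ d * (∑ k ∈ Finset.range (d + 1), N.choose k : ℝ) ≤ (θ + 1) ^ N := by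
    rw [Finset.mul_sum, add_pow]
    simp only [one_pow, mul_one]
    calc _ ≤ ∑ k ∈ Finset.range (d + 1), θ ^ k * (N.choose k : ℝ) := by
          refine Finset.sum_le_sum fun k hk => ?_
          gcongr ?_ * _
          exact pow_le_pow_of_le_one h0.le h1 (Nat.lt_succ_iff.1 (Finset.mem_range.1 hk))
      _ ≤ _ := by
          rw [← Finset.sum_filter_ne_zero]
          refine Finset.sum_le_sum_of_subset_of_nonneg (fun k hk => ?_) fun k _ _ => by positivity
          refine Finset.mem_range.2 (Nat.lt_succ_of_le ?_)
          by_contra hlt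
          exact (Finset.mem_filter.1 hk).2 (by rw [Nat.choose_eq_zero_of_lt (not_le.1 hlt)]; simp)
  have h3 : (θ + 1) ^ N ≤ Real.exp (θ * N) := by
    rw [mul_comm, Real.exp_nat_mul]
    gcongr
    exact Real.add_one_le_exp θ
  have h4 : (0 : ℝ) < θ ^ d := by positivity
  rw [one_div, inv_pow, inv_mul_eq_div, le_div_iff₀ h4, mul_comm]
  exact h2.trans h3

theorem card_traces_le {C : Set (Concept X)} {d : ℕ} (hd : vcDim C ≤ d) {θ : ℝ} (h0 : 0 < θ)
    (h1 : θ ≤ 1) (y : κ → X) :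
    ((traces C y).card : ℝ) ≤ (1 / θ) ^ d * Real.exp (θ * Fintype.card κ) := by
  refine le_trans ?_ (sum_choose_le h0 h1 d (Fintype.card κ))
  exact_mod_cast card_traces_le_sum hd y

theorem card_hypotheses_le {C : Set (Concept X)} (y : κ → X) (P : Set X) [Finite P]
    (hP : P ⊆ Set.range y) : (hypotheses C P).card ≤ (traces C y).card := by
  refine Finset.card_le_card_of_injOn (fun h k => h (y k))
    (fun h hh => trace_mem_traces (mem_of_mem_hypotheses hh) y) fun a ha b hb hab => ?_
  refine eq_of_mem_hypotheses ha hb fun x hx => ?_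
  obtain ⟨k, rfl⟩ := hP hx
  exact congrFun hab k

/-- The indicator of the set of points where `g` and `f` differ. -/
def discord (g f : Concept X) : Concept X := fun x => xor (g x) (f x)

theorem discord_eq_true {g f : Concept X} {x : X} : discord g f x = true ↔ g x ≠ f x := by
  simp [discord]

theorem card_traces_discord_le (C : Set (Concept X)) (f : Concept X) (y : κ → X) :
    (traces {e | ∃ g ∈ C, e = discord g f} y).card ≤ (traces C y).card := by
  classical
  refine (Finset.card_le_card (t := (traces C y).image fun t k => xor (t k) (f (y k)))
    fun t ht => ?_).trans Finset.card_image_le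
  obtain ⟨_, ⟨g, hg, rfl⟩, rfl⟩ := mem_traces.1 ht
  exact Finset.mem_image.2 ⟨_, trace_mem_traces hg y, rfl⟩

theorem card_traces_discord_pair_le (C : Set (Concept X)) (y : κ → X) :
    (traces {e | ∃ g ∈ C, ∃ h ∈ C, e = discord g h} y).card ≤ (traces C y).card ^ 2 := by
  classical
  refine (Finset.card_le_card (t := (traces C y ×ˢ traces C y).image
    fun t k => xor (t.1 k) (t.2 k)) fun t ht => ?_).trans
    (Finset.card_image_le.trans_eq (by rw [Finset.card_product, sq]))
  obtain ⟨_, ⟨g, hg, h, hh, rfl⟩, rfl⟩ := mem_traces.1 ht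
  exact Finset.mem_image.2 ⟨(_, _), Finset.mem_product.2
    ⟨trace_mem_traces hg y, trace_mem_traces hh y⟩, rfl⟩

end Traces

/-! ### Uniform convergence -/

section UniformConvergence

variable {X ι : Type*} [Fintype ι]

/-- The weight `(2/3) ^ k`, where `k` is the number of coordinates at which `t` is true. -/
def penalty (t : ι → Bool) : ℝ≥0∞ := ∏ i, if t i then ((2 / 3 : NNReal) : ℝ≥0∞) else 1

/-- The weight `(4/3) ^ k`, where `k` is the number of coordinates at which `t` is true. -/
def reward (t : ι → Bool) : ℝ≥0∞ := ∏ i, if t i then ((4 / 3 : NNReal) : ℝ≥0∞) else 1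

theorem penalty_eq_pow (t : ι → Bool) :
    penalty t = ((2 / 3 : NNReal) : ℝ≥0∞) ^ (Finset.univ.filter fun i => t i = true).card := by
  rw [penalty, Finset.prod_ite, Finset.prod_const_one, mul_one, Finset.prod_const]

/-- Exchange `inl i` and `inr i` for all `i` with `σ i`. -/
def swapPerm (σ : ι → Bool) : Equiv.Perm (ι ⊕ ι) :=
  Function.Involutive.toPerm
    (Sum.elim (fun i => if σ i then Sum.inr i else Sum.inl i)
      (fun i => if σ i then Sum.inl i else Sum.inr i)) <| by
    rintro (i | i) <;> by_cases h : σ i <;> simp [h]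

theorem traces_comp_perm (C : Set (Concept X)) (y : ι → X) (e : Equiv.Perm ι) :
    traces C (y ∘ e) = (traces C y).map
      ⟨fun t => t ∘ e, fun _ _ h => e.surjective.injective_comp_right h⟩ := by
  ext t
  simp only [mem_traces, Finset.mem_map]
  constructor
  · rintro ⟨g, hg, rfl⟩
    exact ⟨_, ⟨g, hg, rfl⟩, rfl⟩
  · rintro ⟨_, ⟨g, hg, rfl⟩, rfl⟩
    exact ⟨g, hg, rfl⟩

-- The sum factorizes over the coordinates. A pair with no true entry contributes 2, with one it
-- contributes 2/3 + 4/3 = 2, and with two it contributes 2 · 8/9 ≤ 2; the bases of `penalty` and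
-- `reward` are chosen for this.
open Classical in
theorem sum_penalty_mul_reward_le (t : ι ⊕ ι → Bool) :
    ∑ σ : ι → Bool, penalty (fun i => t (swapPerm σ (Sum.inl i))) *
      reward (fun i => t (swapPerm σ (Sum.inr i))) ≤ 2 ^ Fintype.card ι := by
  let p : Bool → ℝ≥0∞ := fun b => if b then ((2 / 3 : NNReal) : ℝ≥0∞) else 1
  let q : Bool → ℝ≥0∞ := fun b => if b then ((4 / 3 : NNReal) : ℝ≥0∞) else 1
  have h1 : ∀ σ : ι → Bool, penalty (fun i => t (swapPerm σ (Sum.inl i))) *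
      reward (fun i => t (swapPerm σ (Sum.inr i))) =
      ∏ i, (p (t (if σ i then Sum.inr i else Sum.inl i)) *
        q (t (if σ i then Sum.inl i else Sum.inr i))) := by
    intro σ
    rw [penalty, reward, ← Finset.prod_mul_distrib]
    rfl
  have h2 := Finset.prod_univ_sum (fun _ : ι => (Finset.univ : Finset Bool))
    fun i b => p (t (if b then Sum.inr i else Sum.inl i)) *
        q (t (if b then Sum.inl i else Sum.inr i))
  rw [Fintype.piFinset_univ] at h2
  simp only [h1]
  rw [← h2, ← Finset.card_univ, ← Finset.prod_const]
  refine Finset.prod_le_prod' fun i _ => ?_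
  rw [Fintype.sum_bool]
  cases h3 : t (Sum.inl i) <;> cases h4 : t (Sum.inr i) <;>
    simp only [p, q, h3, h4, if_true, if_false, Bool.false_eq_true] <;> norm_cast <;>
    rw [← NNReal.coe_le_coe] <;> push_cast <;> norm_num

/-- Symmetrization: exchanging the two halves coordinatewise preserves the product distribution and
permutes the traces. Averaging over all exchanges, every trace contributes at most 1. -/
theorem piExpect_sum_traces_le (μ : PMF X) (𝓔 : Set (Concept X)) {G : ℝ≥0∞}
    (hG : ∀ y : ι ⊕ ι → X, ((traces 𝓔 y).card : ℝ≥0∞) ≤ G) :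
    (piExpect μ fun y : ι ⊕ ι → X => ∑ t ∈ traces 𝓔 y,
      penalty (fun i => t (Sum.inl i)) * reward fun i => t (Sum.inr i)) ≤ G := by
  classical
  set Z : (ι ⊕ ι → X) → ℝ≥0∞ := fun y => ∑ t ∈ traces 𝓔 y,
      penalty (fun i => t (Sum.inl i)) * reward fun i => t (Sum.inr i) with hZ
  have h1 : ∀ σ : ι → Bool, piExpect μ Z = piExpect μ fun y => ∑ t ∈ traces 𝓔 y,
      penalty (fun i => t (swapPerm σ (Sum.inl i))) *
        reward fun i => t (swapPerm σ (Sum.inr i)) := by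
    intro σ
    rw [← piExpect_comp_equiv μ (swapPerm σ) Z]
    refine congrArg _ (funext fun y => ?_)
    simp only [hZ, traces_comp_perm, Finset.sum_map]
    rfl
  have h2 : (2 : ℝ≥0∞) ^ Fintype.card ι * piExpect μ Z ≤ 2 ^ Fintype.card ι * G := by
    calc _ = ∑ _σ : ι → Bool, piExpect μ Z := by
          rw [Finset.sum_const, nsmul_eq_mul, Finset.card_univ, Fintype.card_fun, Fintype.card_bool]
          push_cast
          rfl
      _ = piExpect μ fun y => ∑ t ∈ traces 𝓔 y, ∑ σ : ι → Bool,
          penalty (fun i => t (swapPerm σ (Sum.inl i))) *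
            reward fun i => t (swapPerm σ (Sum.inr i)) := by
          rw [Finset.sum_congr rfl fun σ _ => h1 σ, ← piExpect_finset_sum]
          exact congrArg _ (funext fun y => Finset.sum_comm)
      _ ≤ piExpect μ fun _ : ι ⊕ ι → X => 2 ^ Fintype.card ι * G := by
          refine piExpect_mono μ fun y => ?_
          refine (Finset.sum_le_sum fun t _ => sum_penalty_mul_reward_le t).trans ?_
          rw [Finset.sum_const, nsmul_eq_mul, mul_comm]
          exact mul_le_mul_right (hG y) _
      _ = _ := piExpect_const μ _
  exact (ENNReal.mul_le_mul_iff_right (by simp) (by simp)).1 h2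

theorem le_piExpect_reward (μ : PMF X) (g : Concept X) {η : ℝ} (hη : 0 ≤ η)
    (hg : ENNReal.ofReal η ≤ μ.toOuterMeasure {x | g x = true}) :
    ENNReal.ofReal (1 + η / 3) ^ Fintype.card ι ≤ piExpect μ fun w : ι → X =>
      reward fun i => g (w i) := by
  simp only [reward]
  rw [piExpect_prod μ fun x => if g x then ((4 / 3 : NNReal) : ℝ≥0∞) else 1]
  refine pow_le_pow_left₀ zero_le ?_ _
  have h1 : (fun x => if g x then ((4 / 3 : NNReal) : ℝ≥0∞) else 1) =
      fun x => 1 + ((1 / 3 : NNReal) : ℝ≥0∞) * ({x | g x = true} : Set X).indicator 1 x := by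
    funext x
    by_cases hx : g x = true
    · simp only [hx, if_true, Set.mem_ofPred_eq, Set.indicator_of_mem, Pi.one_apply, mul_one]
      norm_cast
      rw [← NNReal.coe_inj]
      push_cast
      norm_num
    · simp [hx]
  rw [h1, expect_add, expect_const, expect_const_mul]
  rw [toOuterMeasure_eq_expect] at hg
  rw [ENNReal.ofReal_add zero_le_one (by positivity), ENNReal.ofReal_one]
  refine add_le_add_right ?_ _
  rw [div_eq_inv_mul, ENNReal.ofReal_mul (by norm_num)]
  refine mul_le_mul' (le_of_eq ?_) hg
  rw [ENNReal.ofReal, Real.toNNReal_of_nonneg (by norm_num)]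
  congr 1
  exact NNReal.eq (by simp)

/-- A one-sided uniform convergence bound: on a random sample, no member of `𝓔` of large measure has
few points, in the sense of an exponential moment. -/
theorem piExpect_iSup_penalty_le (μ : PMF X) (𝓔 : Set (Concept X)) {η : ℝ} (hη : 0 ≤ η)
    (h𝓔 : ∀ g ∈ 𝓔, ENNReal.ofReal η ≤ μ.toOuterMeasure {x | g x = true}) {G : ℝ≥0∞}
    (hG : ∀ y : ι ⊕ ι → X, ((traces 𝓔 y).card : ℝ≥0∞) ≤ G) :
    (piExpect μ fun w : ι → X => ⨆ g ∈ 𝓔, penalty fun i => g (w i)) *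
      ENNReal.ofReal (1 + η / 3) ^ Fintype.card ι ≤ G := by
  refine le_trans ?_ (piExpect_sum_traces_le μ 𝓔 hG)
  rw [piExpect_sum, mul_comm, ← piExpect_const_mul]
  refine piExpect_mono μ fun w => ?_
  simp only [ENNReal.mul_iSup]
  refine iSup₂_le fun g hg => ?_
  rw [mul_comm]
  -- The second half acts as a ghost sample: the average reward of `g` on it is at least (1 +
  -- η/3)^|ι|. This turns the supremum over `g` into a sum over the traces on the double sample.
  refine (mul_le_mul_right (le_piExpect_reward (ι := ι) μ g hη (h𝓔 g hg)) _).trans ?_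
  rw [← piExpect_const_mul]
  refine piExpect_mono μ fun w' => ?_
  exact Finset.single_le_sum (f := fun t : ι ⊕ ι → Bool =>
    penalty (fun i => t (Sum.inl i)) * reward fun i => t (Sum.inr i)) (fun _ _ => zero_le)
    (trace_mem_traces hg (Sum.elim w w'))

end UniformConvergence

/-! ### The number of unseen elements -/

theorem pow_add_mul_pow_le {a b : ℝ} (ha : 0 ≤ a) (hb : 0 ≤ b) (M : ℕ) :
    a ^ (M + 1) + (M + 1) * a ^ M * b ≤ (a + b) ^ (M + 1) := by
  induction M with
  | zero => simp
  | succ M ih =>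
    have h1 : (a ^ (M + 1) + (M + 1) * a ^ M * b) * (a + b) ≤ (a + b) ^ (M + 1) * (a + b) := by
      gcongr
    have h2 : 0 ≤ (M + 1) * a ^ M * b * b := by positivity
    push_cast
    calc _ ≤ (a ^ (M + 1) + (M + 1) * a ^ M * b) * (a + b) := by ring_nf at h2 ⊢; linarith
      _ ≤ _ := h1
      _ = _ := by ring

/-- An exponential moment of the number of elements outside `A` that are missed by `k` uniform
draws with replacement. -/
theorem sum_pow_card_unseen_le {N : ℕ} (hN : 0 < N) {y : ℝ} (hy0 : 0 ≤ y) (hy1 : y ≤ 1) :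
    ∀ (k : ℕ) (A : Finset (Fin N)),
      ∑ e : Fin k → Fin N, y ^ (A ∪ Finset.univ.image e)ᶜ.card ≤
        (N : ℝ) ^ k * (1 - (1 - y) * (1 - 1 / N) ^ k) ^ Aᶜ.card
  | 0, A => by simp
  | k + 1, A => by
    have hN' : (0 : ℝ) < N := by exact_mod_cast hN
    have hN1 : (1 : ℝ) / N ≤ 1 := by
      rw [div_le_one hN']
      exact_mod_cast hN
    have hi : (0 : ℝ) < 1 / N := by positivity
    set ρ : ℝ := 1 - (1 - y) * (1 - 1 / N) ^ k with hρ
    have hpk0 : 0 ≤ (1 - 1 / (N : ℝ)) ^ k := pow_nonneg (by linarith) k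
    have hpk1 : (1 - 1 / (N : ℝ)) ^ k ≤ 1 := pow_le_one₀ (by linarith) (by linarith)
    have hρ0 : 0 ≤ ρ := by nlinarith
    have hρ1 : ρ ≤ 1 := by nlinarith
    have hstep : 1 - (1 - y) * (1 - 1 / (N : ℝ)) ^ (k + 1) = ρ + (1 - ρ) / N := by
      rw [hρ, pow_succ]
      field_simp
      ring
    have h1 : ∑ e : Fin (k + 1) → Fin N, y ^ (A ∪ Finset.univ.image e)ᶜ.card =
        ∑ a : Fin N, ∑ e : Fin k → Fin N, y ^ (insert a A ∪ Finset.univ.image e)ᶜ.card := by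
      rw [← (Fin.consEquiv fun _ => Fin N).sum_comp, Fintype.sum_prod_type]
      refine Finset.sum_congr rfl fun a _ => Finset.sum_congr rfl fun e _ => ?_
      congr 3
      ext b
      simp [Fin.consEquiv, Fin.exists_fin_succ, or_left_comm, eq_comm]
    -- One more draw lowers the number M of unseen elements by one with probability M/N. The average
    -- is the beginning ρ^M + Mρ^(M-1)(1-ρ)/N of a binomial expansion, so the unseen elements behave
    -- no worse than independent ones.
    have h2 : ∑ a : Fin N, ρ ^ (insert a A)ᶜ.card ≤ N * (ρ + (1 - ρ) / N) ^ Aᶜ.card := by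
      rw [← Finset.sum_add_sum_compl A]
      have hA : ∑ a ∈ A, ρ ^ (insert a A)ᶜ.card = A.card * ρ ^ Aᶜ.card := by
        rw [Finset.sum_congr rfl fun a ha => by rw [Finset.insert_eq_of_mem ha], Finset.sum_const,
          nsmul_eq_mul]
      have hAc : ∑ a ∈ Aᶜ, ρ ^ (insert a A)ᶜ.card = Aᶜ.card * ρ ^ (Aᶜ.card - 1) := by
        rw [Finset.sum_congr rfl fun a ha => by
          rw [Finset.compl_insert, Finset.card_erase_of_mem ha], Finset.sum_const, nsmul_eq_mul]
      have hcard : (A.card : ℝ) = N - Aᶜ.card := by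
        have := Finset.card_add_card_compl A
        rw [Fintype.card_fin] at this
        rw [eq_sub_iff_add_eq]
        exact_mod_cast this
      rw [hA, hAc, hcard]
      generalize Aᶜ.card = M
      rcases M with _ | M
      · simp
      · have h3 := pow_add_mul_pow_le hρ0 (div_nonneg (sub_nonneg.2 hρ1) hN'.le) M
        have h4 := mul_le_mul_of_nonneg_left h3 hN'.le
        refine le_trans (le_of_eq ?_) h4
        push_cast
        rw [pow_succ]
        field_simp
        ring
    calc _ ≤ ∑ a : Fin N, (N : ℝ) ^ k * ρ ^ (insert a A)ᶜ.card := by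
          rw [h1]
          exact Finset.sum_le_sum fun a _ => sum_pow_card_unseen_le hN hy0 hy1 k _
      _ = (N : ℝ) ^ k * ∑ a : Fin N, ρ ^ (insert a A)ᶜ.card := by rw [Finset.mul_sum]
      _ ≤ (N : ℝ) ^ k * (N * (ρ + (1 - ρ) / N) ^ Aᶜ.card) := by gcongr
      _ = _ := by rw [hstep, pow_succ, mul_assoc]

/-- Bernoulli's inequality with exponent N/2 gives (1 - 1/N)^(N/2) ≥ 1/2; then square. -/
theorem quarter_le_one_sub_inv_pow {n N : ℕ} (hN : 2 ≤ N) (h : n ≤ N) :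
    (1 / 4 : ℝ) ≤ (1 - 1 / N) ^ n := by
  have hN' : (2 : ℝ) ≤ N := by exact_mod_cast hN
  have h0 : (1 : ℝ) / N ≤ 1 / 2 := by gcongr
  have hpos : (0 : ℝ) < 1 / N := by positivity
  have h1 : (1 / 2 : ℝ) ≤ (1 - 1 / N) ^ ((N : ℝ) / 2) := by
    have := one_add_mul_self_le_rpow_one_add (s := -(1 / N : ℝ)) (by linarith)
      (p := (N : ℝ) / 2) (by linarith)
    rw [← sub_eq_add_neg] at this
    refine le_trans (le_of_eq ?_) this
    field_simp
    ring
  have h2 : ((1 - 1 / (N : ℝ)) ^ ((N : ℝ) / 2)) ^ 2 = (1 - 1 / (N : ℝ)) ^ N := by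
    rw [← Real.rpow_natCast _ 2, ← Real.rpow_mul (by linarith), ← Real.rpow_natCast _ N]
    congr 1
    push_cast
    ring
  calc (1 / 4 : ℝ) = (1 / 2) ^ 2 := by norm_num
    _ ≤ ((1 - 1 / (N : ℝ)) ^ ((N : ℝ) / 2)) ^ 2 := by gcongr
    _ = (1 - 1 / (N : ℝ)) ^ N := h2
    _ ≤ _ := pow_le_pow_of_le_one (by linarith) (by linarith) h

/-! ### Utility of the final step -/

section Utility

variable {X : Type*}

/-- The points `x` with the labels given by `g`. -/
def labeled {n : ℕ} (g : Concept X) (x : Fin n → X) : Database X n := fun i => (x i, some (g (x i)))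

/-- The points `x` without labels. -/
def unlabeled {n : ℕ} (x : Fin n → X) : Database X n := fun i => (x i, none)

theorem genError_triangle (μ : PMF X) (c g f : Concept X) :
    genError μ c f ≤ genError μ c g + genError μ g f := by
  refine (μ.toOuterMeasure.mono (fun x hx => ?_)).trans
    (MeasureTheory.measure_union_le {x | g x ≠ c x} {x | f x ≠ g x})
  by_contra h
  simp only [Set.mem_union, Set.mem_ofPred_eq, not_or, not_not] at h hx
  exact hx (h.2.trans h.1)

theorem genError_eq_discord (μ : PMF X) (g f : Concept X) :
    genError μ g f = μ.toOuterMeasure {x | discord g f x = true} := by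
  simp only [discord_eq_true, genError, ne_comm]

/-- An upper bound for the number of traces on `N` points of a class of VC dimension `d`. -/
def growthBound (d : ℕ) (θ : ℝ) (N : ℕ) : ℝ := (1 / θ) ^ d * Real.exp (θ * N)

theorem growthBound_nonneg (d : ℕ) {θ : ℝ} (h0 : 0 < θ) (N : ℕ) : 0 ≤ growthBound d θ N := by
  unfold growthBound
  positivity

theorem card_traces_le_growthBound {κ : Type*} [Fintype κ] {C : Set (Concept X)} {d : ℕ}
    (hd : vcDim C ≤ d) {θ : ℝ} (h0 : 0 < θ) (h1 : θ ≤ 1) (y : κ → X) {N : ℕ}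
    (hN : Fintype.card κ ≤ N) :
    ((traces C y).card : ℝ≥0∞) ≤ ENNReal.ofReal (growthBound d θ N) := by
  rw [← ENNReal.ofReal_natCast]
  refine ENNReal.ofReal_le_ofReal ((card_traces_le hd h0 h1 y).trans ?_)
  unfold growthBound
  gcongr

/-- The number of disagreements of `g` and `f` on the tuple `y`. -/
def disagreements {κ : Type*} [Fintype κ] (g f : Concept X) (y : κ → X) : ℕ :=
  (Finset.univ.filter fun i => discord g f (y i) = true).card

theorem one_le_pow_mul_penalty {κ : Type*} [Fintype κ] {g f : Concept X} {y : κ → X} {k : ℕ}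
    (h : disagreements g f y ≤ k) :
    1 ≤ ((3 / 2 : NNReal) : ℝ≥0∞) ^ k * penalty fun i => discord g f (y i) := by
  rw [penalty_eq_pow]
  change 1 ≤ _ * _ ^ disagreements g f y
  norm_cast
  calc (1 : NNReal) = (3 / 2) ^ disagreements g f y * (2 / 3) ^ disagreements g f y := by
        rw [← mul_pow]
        norm_num
    _ ≤ _ := by
        gcongr
        exact (one_le_div (by norm_num)).2 (by norm_num)

/-- For a fixed hypothesis `f`, on a random sample, with high probability no concept of `C` that is
far from `f` has few disagreements with `f`. -/
theorem piExpect_exists_far_le {κ : Type*} [Fintype κ] (μ : PMF X) {C : Set (Concept X)} {d : ℕ}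
    (hd : vcDim C ≤ d) {θ : ℝ} (h0 : 0 < θ) (h1 : θ ≤ 1) {η : ℝ} (hη : 0 ≤ η) (f : Concept X)
    (k N : ℕ) (hN : 2 * Fintype.card κ ≤ N) :
    (piExpect μ fun w : κ → X => ({w | ∃ g ∈ C, ENNReal.ofReal η < genError μ g f ∧
        disagreements g f w ≤ k} : Set (κ → X)).indicator 1 w) ≤
      ((3 / 2 : NNReal) : ℝ≥0∞) ^ k * ENNReal.ofReal (growthBound d θ N) *
        ENNReal.ofReal ((1 + η / 3)⁻¹ ^ Fintype.card κ) := by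
  set 𝓔 : Set (Concept X) := {e | ∃ g ∈ {g ∈ C | ENNReal.ofReal η < genError μ g f},
    e = discord g f} with h𝓔
  have hbase := piExpect_iSup_penalty_le (ι := κ) μ 𝓔 hη (by
    rintro _ ⟨g, hg, rfl⟩
    rw [← genError_eq_discord]
    exact hg.2.le) (G := ENNReal.ofReal (growthBound d θ N)) (by
    intro y
    refine le_trans ?_ (card_traces_le_growthBound hd h0 h1 y (by simpa [two_mul] using hN))
    have hsub : {g ∈ C | ENNReal.ofReal η < genError μ g f} ⊆ C := fun g hg => hg.1
    exact_mod_cast (card_traces_discord_le _ f y).trans (Finset.card_le_card (traces_mono hsub y)))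
  have hpos : 0 < 1 + η / 3 := by positivity
  rw [← ENNReal.ofReal_pow hpos.le] at hbase
  have hp0 : 0 < (1 + η / 3) ^ Fintype.card κ := by positivity
  rw [inv_pow, ENNReal.ofReal_inv_of_pos hp0, mul_assoc, ← div_eq_mul_inv]
  have h2 := (ENNReal.le_div_iff_mul_le (Or.inl (by simpa using hp0))
    (Or.inl ENNReal.ofReal_ne_top)).2 hbase
  refine le_trans ?_ (mul_le_mul_right h2 _)
  rw [← piExpect_const_mul]
  refine piExpect_mono μ fun w => ?_
  by_cases hw : ∃ g ∈ C, ENNReal.ofReal η < genError μ g f ∧ disagreements g f w ≤ k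
  · rw [Set.indicator_of_mem (by exact hw), Pi.one_apply]
    obtain ⟨g, hg, hgη, hgk⟩ := hw
    refine (one_le_pow_mul_penalty hgk).trans (mul_le_mul_right ?_ _)
    exact le_iSup₂ (f := fun (e : Concept X) (_ : e ∈ 𝓔) => penalty fun i => e (w i))
      (discord g f) ⟨g, ⟨hg, hgη⟩, rfl⟩
  · rw [Set.indicator_of_notMem (by exact hw)]
    exact zero_le

/-- The set of hypotheses that are far from `g` but have few disagreements with it on `y`. -/
def deceptive {κ : Type*} [Fintype κ] (μ : PMF X) (η : ℝ) (k : ℕ) (g : Concept X) (y : κ → X) :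
    Set (Concept X) :=
  {f | ENNReal.ofReal η < genError μ g f ∧ disagreements g f y ≤ k}

/-- A learner that sees only a part of a random sample is rarely deceptive on all of it, even if the
sample is labeled by an adversarial concept of `C`. -/
theorem piExpect_iSup_deceptive_le (μ : PMF X) {C : Set (Concept X)} {d : ℕ}
    (hd : vcDim C ≤ d) {θ : ℝ} (h0 : 0 < θ) (h1 : θ ≤ 1) {η : ℝ} (hη : 0 ≤ η) {n N : ℕ}
    (A : Learner X n) (k : ℕ) (e : Fin n → Fin N) :
    (piExpect μ fun y : Fin N → X => ⨆ g ∈ C,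
        (A (labeled g fun i => y (e i))).toOuterMeasure (deceptive μ η k g y)) ≤
      ENNReal.ofReal (growthBound d θ N) * (((3 / 2 : NNReal) : ℝ≥0∞) ^ k *
        ENNReal.ofReal (growthBound d θ (2 * N)) *
          ENNReal.ofReal ((1 + η / 3)⁻¹ ^ (Finset.univ.image e)ᶜ.card)) := by
  classical
  let p : Fin N → Prop := fun i => i ∈ Finset.univ.image e
  let e' : Fin n → {i // p i} := fun i => ⟨e i, Finset.mem_image_of_mem _ (Finset.mem_univ i)⟩
  have hcard : Fintype.card {i // ¬p i} = (Finset.univ.image e)ᶜ.card := by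
    rw [Fintype.card_subtype]
    congr 1
    ext i
    simp [p]
  have hcardS : Fintype.card {i // p i} ≤ N := by
    simpa using Fintype.card_subtype_le p
  have hcardU : Fintype.card {i // ¬p i} ≤ N := by
    simpa only [Fintype.card_fin] using Fintype.card_subtype_le fun i => ¬p i
  let L : ({i // p i} → X) → ({i // p i} → Bool) → Database X n := fun z t i =>
    (z (e' i), some (t (e' i)))
  let V : ({i // ¬p i} → X) → Set (Concept X) := fun w =>
    {f | ∃ g ∈ C, ENNReal.ofReal η < genError μ g f ∧ disagreements g f w ≤ k}
  -- The learner sees `g` only through its trace on the seen points. A sum over these traces makes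
  -- its output independent of the unseen points, so for each fixed output `f` the bound on far
  -- concepts `g` applies to them.
  have hpt : ∀ (z : {i // p i} → X) (w : {i // ¬p i} → X),
      (⨆ g ∈ C, (A (labeled g fun i => Sum.elim z w ((Equiv.sumCompl p).symm (e i)))).toOuterMeasure
        (deceptive μ η k g fun i => Sum.elim z w ((Equiv.sumCompl p).symm i))) ≤
        ∑ t ∈ traces C z, (A (L z t)).toOuterMeasure (V w) := by
    intro z w
    refine iSup₂_le fun g hg => ?_
    refine le_trans ?_ (Finset.single_le_sum (f := fun t => (A (L z t)).toOuterMeasure (V w))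
      (fun _ _ => zero_le) (trace_mem_traces hg z))
    have hL : (labeled g fun i => Sum.elim z w ((Equiv.sumCompl p).symm (e i))) =
        L z fun k => g (z k) := by
      funext i
      have : (Equiv.sumCompl p).symm (e i) = Sum.inl (e' i) :=
        Equiv.sumCompl_symm_apply_of_pos (Finset.mem_image_of_mem _ (Finset.mem_univ i))
      simp [labeled, L, this]
    rw [hL]
    refine (A _).toOuterMeasure.mono fun f hf => ⟨g, hg, hf.1, le_trans ?_ hf.2⟩
    refine Finset.card_le_card_of_injOn (fun i => i.1) (fun i hi => ?_)
      Subtype.val_injective.injOn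
    rw [Finset.mem_coe, Finset.mem_filter] at hi ⊢
    refine ⟨Finset.mem_univ _, ?_⟩
    have : (Equiv.sumCompl p).symm i.1 = Sum.inr i := Equiv.sumCompl_symm_apply_of_neg i.2
    change discord g f (Sum.elim z w ((Equiv.sumCompl p).symm i.1)) = true
    rw [this]
    exact hi.2
  rw [← piExpect_comp_equiv μ (Equiv.sumCompl p).symm, piExpect_sum]
  · refine (piExpect_mono μ fun z => ?_).trans (piExpect_const μ _).le
    refine (piExpect_mono μ fun w => hpt z w).trans ?_
    rw [piExpect_finset_sum]
    refine (Finset.sum_le_sum (g := fun _ => ((3 / 2 : NNReal) : ℝ≥0∞) ^ k *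
        ENNReal.ofReal (growthBound d θ (2 * N)) *
          ENNReal.ofReal ((1 + η / 3)⁻¹ ^ (Finset.univ.image e)ᶜ.card)) fun t _ => ?_).trans ?_
    · simp only [toOuterMeasure_eq_expect]
      rw [piExpect_expect_comm]
      refine expect_le _ fun f => ?_
      rw [← hcard]
      refine le_trans (le_of_eq (congrArg _ (funext fun w => ?_)))
        (piExpect_exists_far_le μ hd h0 h1 hη f k (2 * N) (by omega))
      by_cases hf : f ∈ V w
      · rw [Set.indicator_of_mem hf, Set.indicator_of_mem (by exact hf)]
        rfl
      · rw [Set.indicator_of_notMem hf, Set.indicator_of_notMem (by exact hf)]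
    · rw [Finset.sum_const, nsmul_eq_mul]
      exact mul_le_mul_left (card_traces_le_growthBound hd h0 h1 z hcardS) _

theorem partialLabel_self {n : ℕ} (g : Concept X) (x : Fin n → X) :
    partialLabel g n x = labeled g x := by
  funext i
  simp [partialLabel, labeled]

/-- A learner has small empirical error on the population from which its sample is drawn. -/
theorem expect_resample_labeled_le {n N : ℕ} [Nonempty (Fin N)] {α β : ℝ} (hα : 0 ≤ α)
    {C : Set (Concept X)} {A : Learner X n} (hA : IsSSL α β n n C A) (μ : PMF X) {η : ℝ}
    {g : Concept X} (hg : g ∈ C) (y : Fin N → X) (h : n ≤ N) :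
    (expect (resample n h (labeled g y)) fun B =>
        (A B).toOuterMeasure {f | ENNReal.ofReal η < genError μ g f}) ≤
      ENNReal.ofReal β + expect (iidSample (PMF.uniformOfFintype (Fin N)) n) fun e =>
        (A (labeled g fun i => y (e i))).toOuterMeasure (deceptive μ η ⌊α * N⌋₊ g y) := by
  have h1 := hA g hg ((PMF.uniformOfFintype (Fin N)).map y)
  rw [toOuterMeasure_bind, expect_iidSample_map] at h1
  simp only [partialLabel_self] at h1
  rw [expect_resample, expect_iidSample_map]
  refine le_trans ?_ (add_le_add_left h1 _)
  rw [← expect_add]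
  refine expect_mono _ fun e => ?_
  refine le_trans ((A _).toOuterMeasure.mono ?_) (MeasureTheory.measure_union_le _ _)
  intro f hf
  -- More than αN disagreements mean an error above α under the uniform distribution on the entries
  -- of `y`, which the learner's own guarantee controls; otherwise `f` is deceptive.
  by_cases hk : disagreements g f y ≤ ⌊α * N⌋₊
  · exact Or.inr ⟨hf, hk⟩
  · left
    have hN : (0 : ℝ) < N := by
      exact_mod_cast Fin.pos_iff_nonempty.2 (inferInstance : Nonempty (Fin N))
    have h2 : α * N < disagreements g f y := (Nat.floor_lt (by positivity)).1 (not_le.1 hk)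
    have h3 : genError ((PMF.uniformOfFintype (Fin N)).map y) g f =
        ENNReal.ofReal (disagreements g f y / N) := by
      rw [genError_eq_discord, toOuterMeasure_eq_expect, expect_map, expect_uniformOfFintype,
        Fintype.card_fin, ENNReal.ofReal_div_of_pos hN, ENNReal.ofReal_natCast,
        ENNReal.ofReal_natCast, ENNReal.div_eq_inv_mul, disagreements]
      congr 1
      rw [Finset.card_filter]
      push_cast
      refine Finset.sum_congr rfl fun i _ => ?_
      by_cases hi : discord g f (y i) = true <;> simp [hi]
    rw [Set.mem_ofPred_eq, h3]
    refine (ENNReal.ofReal_lt_ofReal_iff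
      (div_pos (lt_of_le_of_lt (mul_nonneg hα hN.le) h2) hN)).2 ?_
    rwa [lt_div_iff₀ hN]

/-- The failure probability of the final step. -/
def finalBound (α : ℝ) (d : ℕ) (θ : ℝ) (N : ℕ) : ℝ :=
  growthBound d θ N * ((3 / 2) ^ ⌊α * N⌋₊ * growthBound d θ (2 * N) *
    (1 - (1 - (1 + 10 * α / 3)⁻¹) * (1 / 4)) ^ N)

/-- The supremum over `g` is inside the expectation over `y`, because the concept that labels the
kept points depends on them. The guarantee of `A` holds for each `g` separately, so it costs only β;
the deceptive part is averaged over the resampled indices through the exponential moment of the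
unseen points. -/
theorem expect_iSup_resample_le (μ : PMF X) {C : Set (Concept X)} {d : ℕ} (hd : vcDim C ≤ d)
    {θ : ℝ} (h0 : 0 < θ) (h1 : θ ≤ 1) {α β : ℝ} (hα : 0 ≤ α) {n N : ℕ} (hN : 2 ≤ N) (h : n ≤ N)
    {A : Learner X n} (hA : IsSSL α β n n C A) :
    (piExpect μ fun y : Fin N → X => ⨆ g ∈ C, expect (resample n h (labeled g y)) fun B =>
        (A B).toOuterMeasure {f | ENNReal.ofReal (10 * α) < genError μ g f}) ≤
      ENNReal.ofReal β + ENNReal.ofReal (finalBound α d θ N) := by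
  have : Nonempty (Fin N) := ⟨⟨0, by omega⟩⟩
  have hη : 0 ≤ 10 * α := by positivity
  set η := 10 * α
  set k := ⌊α * N⌋₊ with hk
  have hstep : ∀ y : Fin N → X, (⨆ g ∈ C, expect (resample n h (labeled g y)) fun B =>
        (A B).toOuterMeasure {f | ENNReal.ofReal η < genError μ g f}) ≤
      ENNReal.ofReal β + expect (iidSample (PMF.uniformOfFintype (Fin N)) n) fun e =>
        ⨆ g ∈ C, (A (labeled g fun i => y (e i))).toOuterMeasure (deceptive μ η k g y) := by
    intro y
    refine iSup₂_le fun g hg => (expect_resample_labeled_le hα hA μ hg y h).trans ?_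
    gcongr
    refine expect_mono _ fun e => ?_
    exact le_iSup₂ (f := fun (g : Concept X) (_ : g ∈ C) =>
      (A (labeled g fun i => y (e i))).toOuterMeasure (deceptive μ η k g y)) g hg
  refine (piExpect_mono μ hstep).trans ?_
  rw [piExpect_add, piExpect_const]
  gcongr
  rw [piExpect_expect_comm]
  refine (expect_mono _ fun e => piExpect_iSup_deceptive_le μ hd h0 h1 hη A k e).trans ?_
  rw [expect_const_mul, expect_const_mul, finalBound,
    ENNReal.ofReal_mul (growthBound_nonneg d h0 N), ENNReal.ofReal_mul
    (mul_nonneg (by positivity) (growthBound_nonneg d h0 _)), ENNReal.ofReal_mul (by positivity)]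
  have h32 : ENNReal.ofReal ((3 / 2) ^ k) = ((3 / 2 : NNReal) : ℝ≥0∞) ^ k := by
    rw [ENNReal.ofReal_pow (by norm_num)]
    congr 1
    rw [ENNReal.ofReal, Real.toNNReal_of_nonneg (by norm_num)]
    congr 1
  rw [h32]
  gcongr
  have hN' : (0 : ℝ) < N := by exact_mod_cast (by omega : 0 < N)
  have hinv1 : (1 + η / 3)⁻¹ ≤ 1 := inv_le_one_of_one_le₀ (by linarith)
  have hinv0 : 0 ≤ (1 + η / 3)⁻¹ := by positivity
  have hq := quarter_le_one_sub_inv_pow hN h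
  have hq1 : (1 - 1 / (N : ℝ)) ^ n ≤ 1 := by
    have hN2 : (1 : ℝ) / N ≤ 1 := by
      rw [div_le_one hN']
      exact_mod_cast (by omega : 1 ≤ N)
    exact pow_le_one₀ (by linarith) (by linarith [one_div_pos.2 hN'])
  have hsum := sum_pow_card_unseen_le (by omega : 0 < N) hinv0 hinv1 n ∅
  simp only [Finset.empty_union, Finset.compl_empty, Finset.card_univ, Fintype.card_fin] at hsum
  rw [← uniformOfFintype_pi, expect_uniformOfFintype, Fintype.card_fun, Fintype.card_fin,
    Fintype.card_fin, ← ENNReal.ofReal_sum_of_nonneg fun e _ => by positivity,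
    ← ENNReal.ofReal_natCast, ← ENNReal.ofReal_inv_of_pos (by positivity),
    ← ENNReal.ofReal_mul (by positivity)]
  refine ENNReal.ofReal_le_ofReal ?_
  push_cast
  rw [inv_mul_le_iff₀ (by positivity)]
  refine hsum.trans ?_
  gcongr
  nlinarith

end Utility

/-! ### Utility of one iteration -/

section Iteration

variable {X : Type*}

theorem expect_subsample_map {s : ℕ} (r : ℕ) [Nonempty (Fin (s / r) ↪ Fin s)] (B : Database X s)
    (φ : Database X (s / r) → ℝ≥0∞) :
    expect (subsample r B) φ =
      expect (PMF.uniformOfFintype (Fin (s / r) ↪ Fin s)) fun e => φ fun j => B (e j) :=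
  expect_map _ _ _

theorem piExpect_split {u v : ℕ} (hv : v ≤ u) (μ : PMF X)
    (F : (Fin v → X) → (Fin (u - v) → X) → ℝ≥0∞) :
    (piExpect μ fun D : Fin u → X => F (fun j => D (Fin.castLE hv j))
      fun j => D ⟨v + j, by omega⟩) =
      piExpect μ fun T => piExpect μ fun D' => F T D' := by
  let e : Fin v ⊕ Fin (u - v) ≃ Fin u := finSumFinEquiv.trans (finCongr (by omega))
  refine (piExpect_comp_equiv μ e fun x => F (fun j => x (Sum.inl j)) fun j => x (Sum.inr j)).trans
    (piExpect_sum μ _)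

theorem piExpect_append {s t : ℕ} (μ : PMF X) (F : (Fin (s + t) → X) → ℝ≥0∞) :
    (piExpect μ fun y : Fin s → X => piExpect μ fun z : Fin t → X => F (Fin.append y z)) =
      piExpect μ F := by
  rw [← piExpect_comp_equiv μ finSumFinEquiv.symm, piExpect_sum]
  refine congrArg _ (funext fun y => congrArg _ (funext fun z => congrArg F (funext fun i => ?_)))
  refine Fin.addCases (fun j => ?_) (fun j => ?_) i <;> simp

theorem relabel_append {s t : ℕ} (h g : Concept X) (y : Fin s → X) (z : Fin t → X) :
    relabel h (Fin.append (labeled g y) (unlabeled z)) = labeled h (Fin.append y z) := by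
  funext i
  refine Fin.addCases (fun j => ?_) (fun j => ?_) i <;> simp [relabel, labeled, unlabeled]

theorem points_append_subset {s t : ℕ} (g : Concept X) (y : Fin s → X) (z : Fin t → X) :
    points (Fin.append (labeled g y) (unlabeled z)) ⊆ Set.range (Fin.append y z) := by
  rintro _ ⟨i, rfl⟩
  refine ⟨i, ?_⟩
  refine Fin.addCases (fun j => ?_) (fun j => ?_) i <;> simp [labeled, unlabeled]

theorem score_labeled {s : ℕ} (g h : Concept X) (y : Fin s → X) :
    (score (labeled g y) h : ℝ) = s - disagreements g h y := by
  have h1 := Finset.card_filter_add_card_filter_not (s := (Finset.univ : Finset (Fin s)))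
    fun i => discord g h (y i) = true
  have h2 : score (labeled g y) h =
      (Finset.univ.filter fun i => ¬discord g h (y i) = true).card := by
    simp [score, labeled, discord]
  rw [eq_sub_iff_add_eq', h2, disagreements]
  rw [Finset.card_univ, Fintype.card_fin] at h1
  exact_mod_cast h1

theorem exp_neg_half_le : ENNReal.ofReal (Real.exp (-(1 / 2))) ≤ ((2 / 3 : NNReal) : ℝ≥0∞) := by
  have h1 : (3 / 2 : ℝ) ≤ Real.exp (1 / 2) := by linarith [Real.add_one_le_exp (1 / 2 : ℝ)]
  have h2 : Real.exp (-(1 / 2)) ≤ 2 / 3 := by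
    rw [Real.exp_neg]
    exact (inv_anti₀ (by norm_num) h1).trans (by norm_num)
  rw [ENNReal.ofReal, ENNReal.coe_le_coe]
  exact Real.toNNReal_le_iff_le_coe.2 (by simpa using h2)

/-- The indicators of the disagreement of two concepts of `C` at distance more than `η`. -/
def farPairs (μ : PMF X) (C : Set (Concept X)) (η : ℝ) : Set (Concept X) :=
  {e | ∃ g ∈ C, ∃ h ∈ C, e = discord g h ∧ ENNReal.ofReal η < genError μ g h}

/-- The exponential mechanism rarely chooses a concept that is far from the labeling concept. -/
theorem expect_expMechanism_far_le (μ : PMF X) {C : Set (Concept X)} (hC : C.Nonempty) (η : ℝ)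
    {s : ℕ} {g : Concept X} (hg : g ∈ C) (y : Fin s → X) (P : Set X) [Finite P] {G : ℝ≥0∞}
    (hyP : ∀ i, y i ∈ P) (hG : ((hypotheses C P).card : ℝ≥0∞) ≤ G) :
    (expect (expMechanism 1 (hypotheses C P) (hypotheses_nonempty hC P) (labeled g y)) fun h =>
      ({h | ENNReal.ofReal η < genError μ g h} : Set (Concept X)).indicator 1 h) ≤
      G * ⨆ e ∈ farPairs μ C η, penalty fun i => e (y i) := by
  set M := ENNReal.ofReal (Real.exp (s / 2)) with hM
  have hM0 : M ≠ 0 := by simp [hM, Real.exp_pos]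
  have hMt : M ≠ ∞ := ENNReal.ofReal_ne_top
  obtain ⟨h₀, hh₀, heq⟩ := exists_mem_hypotheses (P := P) hg
  have hd0 : disagreements g h₀ y = 0 := by
    rw [disagreements, Finset.card_eq_zero, Finset.filter_eq_empty_iff]
    intro i _
    simp [discord, heq _ (hyP i)]
  have hw : ∀ h ∈ hypotheses C P, expWeight 1 (hypotheses C P) (labeled g y) h *
      ({h | ENNReal.ofReal η < genError μ g h} : Set (Concept X)).indicator 1 h ≤
      M * ⨆ e ∈ farPairs μ C η, penalty fun i => e (y i) := by
    intro h hh
    by_cases hf : ENNReal.ofReal η < genError μ g h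
    · rw [Set.indicator_of_mem (by exact hf), Pi.one_apply, mul_one, expWeight_of_mem hh,
        score_labeled]
      have h1 : Real.exp (1 * ((s : ℝ) - disagreements g h y) / 2) =
          Real.exp (s / 2) * Real.exp (-(1 / 2)) ^ disagreements g h y := by
        rw [← Real.exp_nat_mul, ← Real.exp_add]
        congr 1
        ring
      rw [h1, ENNReal.ofReal_mul (Real.exp_pos _).le, ENNReal.ofReal_pow (Real.exp_pos _).le]
      refine mul_le_mul_right ?_ _
      refine (pow_le_pow_left₀ zero_le exp_neg_half_le _).trans ?_
      refine le_trans (le_of_eq (penalty_eq_pow fun i => discord g h (y i)).symm) ?_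
      exact le_iSup₂ (f := fun (e : Concept X) (_ : e ∈ farPairs μ C η) => penalty fun i => e (y i))
        (discord g h) ⟨g, hg, h, mem_of_mem_hypotheses hh, rfl, hf⟩
    · rw [Set.indicator_of_notMem (by exact hf), mul_zero]
      exact zero_le
  -- The representative of `g` makes no mistake on the sample, so the normalizing constant is at
  -- least exp(s/2).
  have hW : M ≤ ∑ h ∈ hypotheses C P, expWeight 1 (hypotheses C P) (labeled g y) h := by
    refine le_trans (le_of_eq ?_) (Finset.single_le_sum (fun _ _ => zero_le) hh₀)
    rw [expWeight_of_mem hh₀, score_labeled, hd0, hM]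
    simp
  rw [expect_expMechanism]
  refine (mul_le_mul' (Finset.sum_le_sum hw) (ENNReal.inv_le_inv.2 hW)).trans ?_
  rw [Finset.sum_const, nsmul_eq_mul]
  calc _ = ((hypotheses C P).card : ℝ≥0∞) * (⨆ e ∈ farPairs μ C η, penalty fun i => e (y i)) *
        (M * M⁻¹) := by ring
    _ ≤ _ := by
      rw [ENNReal.mul_inv_cancel hM0 hMt, mul_one]
      gcongr

theorem piExpect_farPairs_le (μ : PMF X) {C : Set (Concept X)} {d : ℕ} (hd : vcDim C ≤ d)
    {θ : ℝ} (h0 : 0 < θ) (h1 : θ ≤ 1) {η : ℝ} (hη : 0 ≤ η) (s : ℕ) :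
    (piExpect μ fun y : Fin s → X => ⨆ e ∈ farPairs μ C η, penalty fun i => e (y i)) ≤
      ENNReal.ofReal (growthBound d θ (2 * s) ^ 2 * (1 + η / 3)⁻¹ ^ s) := by
  have hbase := piExpect_iSup_penalty_le (ι := Fin s) μ (farPairs μ C η) hη (by
    rintro _ ⟨g, hg, h, hh, rfl, hlt⟩
    rw [← genError_eq_discord]
    exact hlt.le) (G := ENNReal.ofReal (growthBound d θ (2 * s)) ^ 2) (by
    intro y
    refine le_trans ?_ (pow_le_pow_left₀ zero_le
      (card_traces_le_growthBound hd h0 h1 y (by simp [two_mul])) 2)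
    have hsub : farPairs μ C η ⊆ {e | ∃ g ∈ C, ∃ h ∈ C, e = discord g h} := by
      rintro _ ⟨g, hg, h, hh, rfl, -⟩
      exact ⟨g, hg, h, hh, rfl⟩
    exact_mod_cast (Finset.card_le_card (traces_mono hsub y)).trans
      (card_traces_discord_pair_le C y))
  have hpos : 0 < 1 + η / 3 := by positivity
  have hp0 : 0 < (1 + η / 3) ^ s := by positivity
  rw [Fintype.card_fin, ← ENNReal.ofReal_pow hpos.le] at hbase
  rw [ENNReal.ofReal_mul (by positivity), inv_pow, ENNReal.ofReal_inv_of_pos hp0, ← div_eq_mul_inv,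
    ENNReal.ofReal_pow (growthBound_nonneg d h0 _)]
  exact (ENNReal.le_div_iff_mul_le (Or.inl (by simpa using hp0))
    (Or.inl ENNReal.ofReal_ne_top)).2 hbase

/-- The failure probability of the loop on a random sample that is labeled by an adversarial concept
of `C` at distance at most `a` from `c`. -/
def loopLoss {n : ℕ} (α β : ℝ) (C : Set (Concept X)) (hC : C.Nonempty) (A : Learner X n)
    (μ : PMF X) (c : Concept X) (fuel i s u : ℕ) (a : ℝ) : ℝ≥0∞ :=
  piExpect μ fun x : Fin s → X => ⨆ g ∈ {g ∈ C | genError μ c g ≤ ENNReal.ofReal a},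
    piExpect μ fun D : Fin u → X =>
      (labelBoostLoop α β C hC A fuel i (labeled g x) (unlabeled D)).toOuterMeasure
        {f | ENNReal.ofReal (11 * α) < genError μ c f}

/-- A subsample of i.i.d. points is i.i.d., and `T` is fresh because `g` is chosen before `D` is
averaged out. So the new points are again an i.i.d. sample, labelled by some `h` in `C`. Either `h`
is farther than η from `g`, which is the first summand, or the triangle inequality puts it within a
+ η of `c`, where the supremum in the next loss covers it. -/
theorem loopLoss_succ_le {n : ℕ} (α β : ℝ) {C : Set (Concept X)} (hC : C.Nonempty)
    (A : Learner X n) (μ : PMF X) (c : Concept X) (fuel i : ℕ) {s u v : ℕ} {a η : ℝ}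
    (ha : 0 ≤ a) (hη : 0 ≤ η) (hs : ¬300 * n ≤ s)
    (hv : stretchSize α β (vcDim C).toNat n i s = v) (hvu : v ≤ u) {G : ℝ≥0∞}
    (hG : ∀ y : Fin (s / 100 + v / 100) → X, ((traces C y).card : ℝ≥0∞) ≤ G) :
    loopLoss α β C hC A μ c (fuel + 1) i s u a ≤
      G * (piExpect μ fun y : Fin (s / 100) → X => ⨆ e ∈ farPairs μ C η, penalty fun i => e (y i)) +
        loopLoss α β C hC A μ c fuel (i + 1) (s / 100 + v / 100) (u - v) (a + η) := by
  subst hv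
  set v := stretchSize α β (vcDim C).toNat n i s with hv
  set bad : Set (Concept X) := {f | ENNReal.ofReal (11 * α) < genError μ c f} with hbad
  have : Nonempty (Fin (s / 100) ↪ Fin s) := ⟨Fin.castLEEmb (Nat.div_le_self s _)⟩
  have : Nonempty (Fin (v / 100) ↪ Fin v) := ⟨Fin.castLEEmb (Nat.div_le_self v _)⟩
  let Ξ : (Fin (s / 100) → X) → ℝ≥0∞ := fun y => ⨆ e ∈ farPairs μ C η, penalty fun i => e (y i)
  let Y : (Fin (s / 100 + v / 100) → X) → ℝ≥0∞ := fun x =>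
    ⨆ g ∈ {g ∈ C | genError μ c g ≤ ENNReal.ofReal (a + η)}, piExpect μ fun D : Fin (u - v) → X =>
      (labelBoostLoop α β C hC A fuel (i + 1) (labeled g x) (unlabeled D)).toOuterMeasure bad
  have hproc : ∀ (g : Concept X), g ∈ C → genError μ c g ≤ ENNReal.ofReal a →
      ∀ (y : Fin (s / 100) → X) (t : Fin (v / 100) → X),
      (piExpect μ fun D' : Fin (u - v) → X =>
        expect (labelBoostProcedure C hC (labeled g y) (unlabeled t)) fun S₂ =>
          (labelBoostLoop α β C hC A fuel (i + 1) S₂ (unlabeled D')).toOuterMeasure bad) ≤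
        G * Ξ y + Y (Fin.append y t) := by
    intro g hg hga y t
    have hcard : ((hypotheses C (points (Fin.append (labeled g y) (unlabeled t)))).card : ℝ≥0∞)
        ≤ G := by
      refine le_trans ?_ (hG (Fin.append y t))
      exact_mod_cast card_hypotheses_le _ _ (points_append_subset g y t)
    have hmem : ∀ j, y j ∈ points (Fin.append (labeled g y) (unlabeled t)) := fun j =>
      ⟨Fin.castAdd _ j, by simp [labeled]⟩
    refine le_trans ?_ (add_le_add_left
      (expect_expMechanism_far_le μ hC η hg y _ hmem hcard) _)
    rw [← expect_add_const, piExpect_expect_comm]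
    rw [expect_labelBoostProcedure]
    refine expect_mono_support _ fun h hh => ?_
    rw [relabel_append]
    have hhH : h ∈ hypotheses C (points (Fin.append (labeled g y) (unlabeled t))) := by
      by_contra hcon
      refine hh ?_
      simp [expMechanism, PMF.normalize_apply, expWeight, hcon]
    by_cases hfar : ENNReal.ofReal η < genError μ g h
    · rw [Set.indicator_of_mem (by exact hfar), Pi.one_apply]
      refine le_add_right ?_
      exact (piExpect_mono μ fun D => toOuterMeasure_le_one _ _).trans (piExpect_const μ 1).le
    · refine le_add_left ?_
      refine le_iSup₂ (f := fun (g : Concept X)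
        (_ : g ∈ {g ∈ C | genError μ c g ≤ ENNReal.ofReal (a + η)}) =>
        piExpect μ fun D : Fin (u - v) → X => (labelBoostLoop α β C hC A fuel (i + 1)
          (labeled g (Fin.append y t)) (unlabeled D)).toOuterMeasure bad) h
        ⟨mem_of_mem_hypotheses hhH, ?_⟩
      rw [ENNReal.ofReal_add ha hη]
      exact (genError_triangle μ c g h).trans (add_le_add hga (not_lt.1 hfar))
  have hx : ∀ x : Fin s → X, (⨆ g ∈ {g ∈ C | genError μ c g ≤ ENNReal.ofReal a},
      piExpect μ fun D : Fin u → X => (labelBoostLoop α β C hC A (fuel + 1) i (labeled g x)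
        (unlabeled D)).toOuterMeasure bad) ≤
      expect (PMF.uniformOfFintype (Fin (s / 100) ↪ Fin s)) fun e => G * Ξ (x ∘ e) +
        piExpect μ fun t : Fin (v / 100) → X => Y (Fin.append (x ∘ e) t) := by
    intro x
    refine iSup₂_le fun g hg => ?_
    have hloop : ∀ D : Fin u → X, (labelBoostLoop α β C hC A (fuel + 1) i (labeled g x)
        (unlabeled D)).toOuterMeasure bad =
        expect (PMF.uniformOfFintype (Fin (s / 100) ↪ Fin s)) fun e₁ =>
          expect (PMF.uniformOfFintype (Fin (v / 100) ↪ Fin v)) fun e₂ =>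
            expect (labelBoostProcedure C hC (labeled g (x ∘ e₁))
              (unlabeled fun j => D (Fin.castLE hvu (e₂ j)))) fun S₂ =>
              (labelBoostLoop α β C hC A fuel (i + 1) S₂
                (unlabeled fun j : Fin (u - v) => D ⟨v + j, by omega⟩)).toOuterMeasure bad := by
      intro D
      rw [labelBoostLoop]
      simp only [hs, dif_neg, not_false_eq_true, ← hv, hvu, dif_pos, toOuterMeasure_bind,
        expect_subsample_map]
      rfl
    simp only [hloop]
    rw [piExpect_expect_comm]
    refine expect_mono _ fun e₁ => ?_
    rw [piExpect_expect_comm]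
    refine expect_le _ fun e₂ => ?_
    rw [piExpect_split hvu μ fun T D' => expect (labelBoostProcedure C hC (labeled g (x ∘ e₁))
      (unlabeled fun j => T (e₂ j))) fun S₂ =>
        (labelBoostLoop α β C hC A fuel (i + 1) S₂ (unlabeled D')).toOuterMeasure bad]
    refine (piExpect_comp_embedding μ e₂ fun t => piExpect μ fun D' =>
      expect (labelBoostProcedure C hC (labeled g (x ∘ e₁)) (unlabeled t)) fun S₂ =>
        (labelBoostLoop α β C hC A fuel (i + 1) S₂ (unlabeled D')).toOuterMeasure bad).trans_le ?_
    refine (piExpect_mono μ fun t => hproc g hg.1 hg.2 _ t).trans ?_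
    rw [piExpect_add, piExpect_const]
  refine (piExpect_mono μ hx).trans ?_
  rw [piExpect_expect_comm]
  refine expect_le _ fun e => ?_
  rw [piExpect_comp_embedding μ e fun y => G * Ξ y + piExpect μ fun t : Fin (v / 100) → X =>
    Y (Fin.append y t), piExpect_add, piExpect_const_mul, piExpect_append]
  exact le_rfl

/-- The output has error at most 10α against the current labelling concept, which is itself within a
≤ α of `c`; hence 11α. -/
theorem loopLoss_final_le {n : ℕ} {α β : ℝ} (hα : 0 ≤ α) {C : Set (Concept X)} (hC : C.Nonempty)
    {A : Learner X n} (hA : IsSSL α β n n C A) (μ : PMF X) (c : Concept X) (fuel i : ℕ) {s u : ℕ}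
    {a : ℝ} (ha0 : 0 ≤ a) (ha : a ≤ α) (hs : 300 * n ≤ s) (hs2 : 600 ≤ s) {d : ℕ}
    (hd : vcDim C ≤ d) {θ : ℝ} (h0 : 0 < θ) (h1 : θ ≤ 1) :
    loopLoss α β C hC A μ c (fuel + 1) i s u a ≤
      ENNReal.ofReal β + ENNReal.ofReal (finalBound α d θ (s / 300)) := by
  have : Nonempty (Fin (s / 300) ↪ Fin s) := ⟨Fin.castLEEmb (Nat.div_le_self s _)⟩
  have hn : n ≤ s / 300 := (Nat.le_div_iff_mul_le (by norm_num)).2 (by omega)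
  refine le_trans ?_ (expect_iSup_resample_le μ hd h0 h1 hα (by omega) hn hA)
  let Y : (Fin (s / 300) → X) → ℝ≥0∞ := fun y =>
    ⨆ g ∈ C, expect (resample n hn (labeled g y)) fun B =>
      (A B).toOuterMeasure {f | ENNReal.ofReal (10 * α) < genError μ g f}
  have hx : ∀ x : Fin s → X, (⨆ g ∈ {g ∈ C | genError μ c g ≤ ENNReal.ofReal a},
      piExpect μ fun D : Fin u → X => (labelBoostLoop α β C hC A (fuel + 1) i (labeled g x)
        (unlabeled D)).toOuterMeasure {f | ENNReal.ofReal (11 * α) < genError μ c f}) ≤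
      expect (PMF.uniformOfFintype (Fin (s / 300) ↪ Fin s)) fun e => Y (x ∘ e) := by
    intro x
    refine iSup₂_le fun g hg => ?_
    have hsub : {f | ENNReal.ofReal (11 * α) < genError μ c f} ⊆
        {f | ENNReal.ofReal (10 * α) < genError μ g f} := by
      intro f hf
      by_contra hcon
      refine absurd hf (not_lt.2 ((genError_triangle μ c g f).trans
        ((add_le_add hg.2 (not_lt.1 hcon)).trans ?_)))
      rw [← ENNReal.ofReal_add ha0 (by positivity)]
      exact ENNReal.ofReal_le_ofReal (by linarith)
    refine (piExpect_mono μ fun D => MeasureTheory.measure_mono hsub).trans ?_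
    simp only [labelBoostLoop, hs, dif_pos, finalStep, toOuterMeasure_bind, expect_subsample_map, piExpect_const]
    exact expect_mono _ fun e => le_iSup₂ (f := fun (g : Concept X) (_ : g ∈ C) =>
      expect (resample n hn (labeled g (x ∘ e))) fun B =>
        (A B).toOuterMeasure {f | ENNReal.ofReal (10 * α) < genError μ g f}) g hg.1
  refine (piExpect_mono μ hx).trans ?_
  rw [piExpect_expect_comm]
  exact expect_le _ fun e => (piExpect_comp_embedding μ e Y).le

theorem labelBoost_isSSL_of_loopLoss {n : ℕ} {α β β' : ℝ} {C : Set (Concept X)} (hC : C.Nonempty)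
    {A : Learner X n} {m : ℕ}
    (h : ∀ (μ : PMF X) (c : Concept X),
      loopLoss α β C hC A μ c (m + 90000 * n + 1) 1 m (90000 * n) 0 ≤ ENNReal.ofReal β') :
    IsSSL (11 * α) β' (m + 90000 * n) m C (labelBoost α β C hC A m) := by
  intro c hc μ
  refine le_trans ?_ (h μ c)
  rw [toOuterMeasure_bind, expect_iidSample, ← piExpect_append, loopLoss]
  refine piExpect_mono μ fun x => ?_
  refine le_trans (le_of_eq (congrArg _ (funext fun D => ?_))) (le_iSup₂ (f := fun (g : Concept X)
    (_ : g ∈ {g ∈ C | genError μ c g ≤ ENNReal.ofReal 0}) => piExpect μ fun D => (labelBoostLoop α β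
      C hC A (m + 90000 * n + 1) 1 (labeled g x) (unlabeled D)).toOuterMeasure
        {f | ENNReal.ofReal (11 * α) < genError μ c f}) c ⟨hc, ?_⟩)
  · rw [labelBoost]
    congr 3
    · funext i
      simp [partialLabel, labeled]
    · funext i
      simp [partialLabel, unlabeled]
  · simp [genError]

end Iteration

/-! ### Numerical estimates -/

section Numerics

variable {α β : ℝ} {d : ℕ}

theorem three_le_log_inv (hα : 0 < α) (hα1 : α < 1 / 11) (hβ : 0 < β) (hβ1 : β < 1 / 2) :
    3 ≤ Real.log (1 / (α * β)) := by
  rw [Real.le_log_iff_exp_le (by positivity)]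
  have h1 : Real.exp 3 ≤ 22 := by
    have h3 : Real.exp 3 = Real.exp 1 ^ 3 := by rw [← Real.exp_nat_mul]; norm_num
    rw [h3]
    calc Real.exp 1 ^ 3 ≤ 2.7182818286 ^ 3 := by gcongr; exact Real.exp_one_lt_d9.le
      _ ≤ 22 := by norm_num
  refine h1.trans ?_
  rw [le_div_iff₀ (by positivity)]
  nlinarith

theorem const_mul_four_pow_le_exp {i : ℕ} (hi : 1 ≤ i) :
    (64000000 : ℝ) * 4 ^ i ≤ Real.exp (12 * 2 ^ i) := by
  have hp : (2 : ℝ) ≤ 2 ^ i := by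
    calc (2 : ℝ) = 2 ^ 1 := by norm_num
      _ ≤ 2 ^ i := pow_le_pow_right₀ (by norm_num) hi
  have h4 : (4 : ℝ) ^ i = 2 ^ i * 2 ^ i := by rw [← mul_pow]; norm_num
  have h20 : (64000000 : ℝ) ≤ Real.exp 20 := by
    have h3 : Real.exp 20 = Real.exp 1 ^ 20 := by rw [← Real.exp_nat_mul]; norm_num
    rw [h3]
    calc (64000000 : ℝ) ≤ 2.7 ^ 20 := by norm_num
      _ ≤ Real.exp 1 ^ 20 := by gcongr; linarith [Real.exp_one_gt_d9]
  have h1 : (2 : ℝ) ^ i ≤ Real.exp (2 ^ i) := by linarith [Real.add_one_le_exp ((2 : ℝ) ^ i)]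
  calc (64000000 : ℝ) * 4 ^ i ≤ Real.exp 20 * (Real.exp (2 ^ i) * Real.exp (2 ^ i)) := by
        rw [h4]
        gcongr
    _ = Real.exp (20 + (2 ^ i + 2 ^ i)) := by rw [← Real.exp_add, ← Real.exp_add]
    _ ≤ _ := Real.exp_le_exp.2 (by linarith)

/-- With x the exponent, the assumption says x ≥ 10 · 2^i · log(1/(αβ)). One factor exp(x/2) beats
the constants and 4^i/(αβ), the other beats the linear term x/2. -/
theorem sample_growth (hα : 0 < α) (hβ : 0 < β) (hd : 1 ≤ d) (hL : 3 ≤ Real.log (1 / (α * β)))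
    {i : ℕ} (hi : 1 ≤ i) {s : ℝ} (hs : 20000 * 4 ^ i * (d / α * Real.log (1 / (α * β))) ≤ s) :
    4000 * s ≤ β / (4 * 2 ^ i) * d * Real.exp (α / (10 * 2 ^ i) * s / (200 * d)) := by
  set L := Real.log (1 / (α * β)) with hLdef
  have hd0 : (0 : ℝ) < d := by exact_mod_cast hd
  have hp : (2 : ℝ) ≤ 2 ^ i := by
    calc (2 : ℝ) = 2 ^ 1 := by norm_num
      _ ≤ 2 ^ i := pow_le_pow_right₀ (by norm_num) hi
  have h4 : (4 : ℝ) ^ i = 2 ^ i * 2 ^ i := by rw [← mul_pow]; norm_num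
  have h64 := const_mul_four_pow_le_exp hi
  rw [h4] at hs h64
  set p : ℝ := 2 ^ i with hpdef
  set x := α / (10 * p) * s / (200 * d) with hx
  have hsx : s = 2000 * p * d * x / α := by
    rw [hx]
    field_simp
    ring
  have hxL : 10 * p * L ≤ x := by
    rw [hsx, le_div_iff₀ hα] at hs
    have h1 : 20000 * (p * p) * (d / α * L) * α = 20000 * (p * p) * d * L := by
      field_simp
    rw [h1] at hs
    have h2 : 2000 * p * d * (10 * p * L) ≤ 2000 * p * d * x := by linarith
    exact le_of_mul_le_mul_left h2 (by positivity)
  have hx0 : 0 ≤ x := le_trans (by positivity) hxL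
  have hexp : 64000000 * (p * p) / (α * β) ≤ Real.exp (x / 2) := by
    calc 64000000 * (p * p) / (α * β) = 64000000 * (p * p) * (1 / (α * β)) := by ring
      _ ≤ Real.exp (12 * p) * Real.exp L := by
          rw [hLdef, Real.exp_log (by positivity)]
          gcongr
      _ = Real.exp (12 * p + L) := by rw [Real.exp_add]
      _ ≤ _ := Real.exp_le_exp.2 (by nlinarith)
  have hhalf : x / 2 ≤ Real.exp (x / 2) := by linarith [Real.add_one_le_exp (x / 2)]
  have hee : Real.exp x = Real.exp (x / 2) * Real.exp (x / 2) := by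
    rw [← Real.exp_add]
    congr 1
    ring
  rw [hsx, hee]
  calc 4000 * (2000 * p * d * x / α) =
        β / (4 * p) * d * (64000000 * (p * p) / (α * β) * (x / 2)) := by
        field_simp
        ring
    _ ≤ _ := by gcongr

theorem inv_one_add_le_exp {a : ℝ} (ha : 0 ≤ a) (ha1 : a ≤ 1 / 5) :
    (1 + 10 * a / 3)⁻¹ ≤ Real.exp (-(2 * a)) := by
  refine le_trans ?_ (Real.one_sub_le_exp_neg (2 * a))
  rw [inv_le_iff_one_le_mul₀ (by positivity)]
  nlinarith

/-- The bound for the failure probability of one iteration. -/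
theorem iteration_bound {a x b : ℝ} (hd : 1 ≤ d) (ha : 0 < a) (ha1 : a ≤ 1 / 5) (hb : 0 ≤ b)
    (hx : 10 / a ≤ Real.exp (x - 2)) {s : ℕ} (hs : a * s = 200 * d * x) (s₁ : ℕ)
    (hs₁ : s₁ = s / 100) :
    b * Real.exp (d * x) * (growthBound d (a / 10) (2 * s₁) ^ 2 * (1 + 10 * a / 3)⁻¹ ^ s₁) ≤ b := by
  have hd' : (1 : ℝ) ≤ d := by exact_mod_cast hd
  have h1 : (s : ℝ) ≤ 100 * s₁ + 100 := by exact_mod_cast (by omega : s ≤ 100 * s₁ + 100)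
  have h2 : 200 * d * x ≤ 100 * (a * s₁) + 20 := by nlinarith
  have h3 : growthBound d (a / 10) (2 * s₁) ≤
      Real.exp (d * (x - 2)) * Real.exp (a / 10 * (2 * s₁)) := by
    unfold growthBound
    push_cast
    rw [one_div_div, Real.exp_nat_mul]
    gcongr
  have h4 : (1 + 10 * a / 3)⁻¹ ^ s₁ ≤ Real.exp (s₁ * (-(2 * a))) := by
    rw [Real.exp_nat_mul]
    gcongr
    exact inv_one_add_le_exp ha.le ha1
  have h5 : 0 ≤ growthBound d (a / 10) (2 * s₁) := growthBound_nonneg d (by positivity) _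
  calc _ ≤ b * Real.exp (d * x) * ((Real.exp (d * (x - 2)) * Real.exp (a / 10 * (2 * s₁))) ^ 2 *
        Real.exp (s₁ * (-(2 * a)))) := by gcongr
    _ = b * Real.exp (d * x + (d * (x - 2) + a / 10 * (2 * s₁)) + (d * (x - 2) +
          a / 10 * (2 * s₁)) + s₁ * (-(2 * a))) := by
        simp only [Real.exp_add]
        ring
    -- The exponent is 3dx - 4d - 1.6as₁, and as₁ ≥ 2dx - 0.2 because s₁ is about s/100.
    _ ≤ b * Real.exp 0 := by
        gcongr
        nlinarith
    _ = b := by rw [Real.exp_zero, mul_one]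

/-- The bound for the size of the solution set in one iteration. -/
theorem card_traces_iteration_le {X κ : Type*} [Fintype κ] {C : Set (Concept X)}
    (hC : vcDim C ≤ d) (hd : 1 ≤ d) {b x : ℝ} (hb0 : 0 < b) (hb1 : b ≤ 1)
    (hbig : 100 ≤ b * Real.exp x) (y : κ → X)
    (hcard : (Fintype.card κ : ℝ) ≤ b * d * Real.exp x / 100) :
    ((traces C y).card : ℝ≥0∞) ≤ ENNReal.ofReal (b * Real.exp (d * x)) := by
  -- The choice θ = 100/(b exp x) makes θ times the number of points at most d; this is what the
  -- exponential cap on `v` in the algorithm is for.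
  have hpos : 0 < b * Real.exp x := by positivity
  have h0 : 0 < 100 / (b * Real.exp x) := by positivity
  have h1 : 100 / (b * Real.exp x) ≤ 1 := (div_le_one hpos).2 hbig
  have h2 := card_traces_le hC h0 h1 y
  rw [← ENNReal.ofReal_natCast]
  refine ENNReal.ofReal_le_ofReal (h2.trans ?_)
  have h3 : 100 / (b * Real.exp x) * Fintype.card κ ≤ d * 1 := by
    rw [div_mul_eq_mul_div, div_le_iff₀ hpos]
    linarith
  have he : Real.exp 1 ≤ 100 := by linarith [Real.exp_one_lt_d9]
  calc _ ≤ (b * Real.exp x / 100) ^ d * Real.exp (d * 1) := by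
        rw [one_div_div]
        gcongr
    _ = b ^ d * Real.exp (d * x) * (Real.exp 1 / 100) ^ d := by
        rw [Real.exp_nat_mul, Real.exp_nat_mul, ← mul_pow, ← mul_pow, ← mul_pow]
        congr 1
        ring
    _ ≤ b ^ 1 * Real.exp (d * x) * 1 := by
        gcongr ?_ * _ * ?_
        · exact pow_le_pow_of_le_one hb0.le hb1 hd
        · exact pow_le_one₀ (by positivity) ((div_le_one (by norm_num)).2 he)
    _ = _ := by ring

theorem finalBound_le (hα : 0 < α) (hα1 : α < 1 / 11) (hβ : 0 < β) (hβ1 : β < 1 / 2) (hd : 1 ≤ d)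
    {s : ℕ} (hs : 80000 * (d / α * Real.log (1 / (α * β))) ≤ s) :
    finalBound α d (α / 50) (s / 300) ≤ β / 2 := by
  have hL := three_le_log_inv hα hα1 hβ hβ1
  set L := Real.log (1 / (α * β)) with hLdef
  have hd' : (1 : ℝ) ≤ d := by exact_mod_cast hd
  set N := s / 300 with hN
  have h1 : (s : ℝ) ≤ 300 * N + 300 := by exact_mod_cast (by omega : s ≤ 300 * N + 300)
  have h2 : 80000 * (d * L) ≤ 300 * (α * N) + 30 := by
    have h3 : d / α * L = d * L / α := by ring
    rw [h3, ← mul_div_assoc, div_le_iff₀ hα] at hs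
    nlinarith
  have hg : ∀ M : ℕ, growthBound d (α / 50) M ≤ Real.exp (d * (4 + L)) * Real.exp (α / 50 * M) := by
    intro M
    unfold growthBound
    rw [one_div_div, Real.exp_nat_mul]
    gcongr
    have h50 : (50 : ℝ) ≤ Real.exp 4 := by
      have h3 : Real.exp 4 = Real.exp 1 ^ 4 := by rw [← Real.exp_nat_mul]; norm_num
      rw [h3]
      calc (50 : ℝ) ≤ 2.7 ^ 4 := by norm_num
        _ ≤ Real.exp 1 ^ 4 := by gcongr; linarith [Real.exp_one_gt_d9]
    rw [Real.exp_add, hLdef, Real.exp_log (by positivity), div_eq_mul_one_div]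
    gcongr
    nlinarith
  have hk : (3 / 2 : ℝ) ^ ⌊α * N⌋₊ ≤ Real.exp (42 / 100 * (α * N)) := by
    have h3 : (3 / 2 : ℝ) ≤ Real.exp (42 / 100) := by
      have := Real.quadratic_le_exp_of_nonneg (x := 42 / 100) (by norm_num)
      linarith
    calc (3 / 2 : ℝ) ^ ⌊α * N⌋₊ ≤ Real.exp (42 / 100) ^ ⌊α * N⌋₊ := by gcongr
      _ = Real.exp (⌊α * N⌋₊ * (42 / 100)) := (Real.exp_nat_mul _ _).symm
      _ ≤ _ := by
        refine Real.exp_le_exp.2 ?_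
        have := Nat.floor_le (by positivity : 0 ≤ α * N)
        linarith
  have hinv : (1 + 10 * α / 3)⁻¹ ≤ 1 - 252 / 100 * α := by
    rw [inv_le_iff_one_le_mul₀ (by positivity)]
    nlinarith
  have hinv0 : 0 ≤ (1 + 10 * α / 3)⁻¹ := by positivity
  have hu : (1 - (1 - (1 + 10 * α / 3)⁻¹) * (1 / 4)) ^ N ≤ Real.exp (N * (-(63 / 100 * α))) := by
    rw [Real.exp_nat_mul]
    refine pow_le_pow_left₀ (by linarith) ?_ N
    refine le_trans ?_ (Real.one_sub_le_exp_neg _)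
    linarith
  have hu0 : 0 ≤ 1 - (1 - (1 + 10 * α / 3)⁻¹) * (1 / 4) := by linarith
  have hgn : ∀ M : ℕ, 0 ≤ growthBound d (α / 50) M := growthBound_nonneg d (by positivity)
  have hab : Real.exp (-(2 * L)) ≤ β / 2 := by
    have h3 : Real.exp (-(2 * L)) = (α * β) * (α * β) := by
      have h4 : -(2 * L) = Real.log (α * β) + Real.log (α * β) := by
        rw [hLdef, one_div, Real.log_inv]
        ring
      rw [h4, Real.exp_add, Real.exp_log (by positivity)]
    rw [h3]
    have h5 : α * β ≤ 1 / 11 * (1 / 2) := by gcongr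
    nlinarith [mul_pos hα hβ]
  calc finalBound α d (α / 50) N ≤
        (Real.exp (d * (4 + L)) * Real.exp (α / 50 * N)) * (Real.exp (42 / 100 * (α * N)) *
          (Real.exp (d * (4 + L)) * Real.exp (α / 50 * (2 * N : ℕ))) *
            Real.exp (N * (-(63 / 100 * α)))) := by
        unfold finalBound
        have := hgn N
        have := hgn (2 * N)
        gcongr
        · exact hg N
        · exact hg (2 * N)
    _ = Real.exp ((d * (4 + L) + α / 50 * N) + ((42 / 100 * (α * N) + (d * (4 + L) +
          α / 50 * (2 * N : ℕ))) + N * (-(63 / 100 * α)))) := by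
        simp only [Real.exp_add]
    -- The coefficient of αN is 0.02 + 0.42 + 0.04 - 0.63 = -0.15, and αN is at least about 266dL,
    -- which outweighs 2d(4 + L) + 2L.
    _ ≤ Real.exp (-(2 * L)) := by
        refine Real.exp_le_exp.2 ?_
        push_cast
        nlinarith [mul_le_mul_of_nonneg_left hL (by linarith : (0 : ℝ) ≤ d),
          mul_le_mul_of_nonneg_right hd' (by linarith : 0 ≤ L)]
    _ ≤ _ := hab

end Numerics

/-! ### Utility of `LabelBoost` -/

section Main

variable {X : Type*}

theorem stretchSize_cases (α β : ℝ) (d n i s : ℕ)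
    (h : 4000 * (s : ℝ) ≤
      β / (4 * 2 ^ i) * d * Real.exp (α / (10 * 2 ^ i) * s / (200 * d))) :
    stretchSize α β d n i s ≤ 30000 * n ∧
      (stretchSize α β d n i s = 30000 * n ∨ 3999 * s ≤ stretchSize α β d n i s) ∧
      (s : ℝ) + stretchSize α β d n i s ≤
        β / (4 * 2 ^ i) * d * Real.exp (α / (10 * 2 ^ i) * s / (200 * d)) := by
  unfold stretchSize
  set E := β / (4 * 2 ^ i) * d * Real.exp (α / (10 * 2 ^ i) * s / (200 * d))
  have hs0 : (0 : ℝ) ≤ s := Nat.cast_nonneg s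
  have hnn : 0 ≤ min (30000 * n : ℝ) (E - s) := le_min (by positivity) (by linarith)
  have hfl := Nat.floor_le hnn
  refine ⟨?_, ?_, ?_⟩
  · have h1 := hfl.trans (min_le_left _ _)
    exact_mod_cast h1
  · rcases le_total (30000 * n : ℝ) (E - s) with h1 | h1
    · left
      rw [min_eq_left h1]
      exact_mod_cast Nat.floor_natCast (R := ℝ) (30000 * n)
    · right
      rw [min_eq_right h1]
      refine Nat.le_floor ?_
      push_cast
      linarith
  · linarith [hfl.trans (min_le_right _ _)]

/-- The radius α(1 - 2/2^i) is the sum of the distances 10αⱼ for j < i. The bound consists of β for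
the learner, β/2 for the final generalization, and β/2^i, which more than covers the remaining βⱼ.
The hypotheses are invariants: `fuel + s` pays for termination, 4^i drives the growth, and `u + 200
* s` is a potential that never drops below 90000n while the loop runs. -/
theorem loopLoss_le {n d : ℕ} {α β : ℝ} (hα : 0 < α) (hα1 : α < 1 / 11) (hβ : 0 < β)
    (hβ1 : β < 1 / 2) {C : Set (Concept X)} (hC : C.Nonempty) (hCd : vcDim C = d) (hd : 1 ≤ d)
    {A : Learner X n} (hA : IsSSL α β n n C A) (μ : PMF X) (c : Concept X) :
    ∀ (fuel i s u : ℕ), 1 ≤ i → 1 ≤ fuel → 300 * n + 1 ≤ fuel + s →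
      80000 * (d / α * Real.log (1 / (α * β))) ≤ s →
      (s < 300 * n → 20000 * 4 ^ i * (d / α * Real.log (1 / (α * β))) ≤ s ∧
        90000 * n ≤ u + 200 * s) →
      loopLoss α β C hC A μ c fuel i s u (α * (1 - 2 / 2 ^ i)) ≤
        ENNReal.ofReal (β * (3 / 2 + 1 / 2 ^ i)) := by
  have hL := three_le_log_inv hα hα1 hβ hβ1
  have hd' : (1 : ℝ) ≤ d := by exact_mod_cast hd
  set L := Real.log (1 / (α * β)) with hLdef
  have hdL : 33 ≤ d / α * L := by
    rw [div_mul_eq_mul_div, le_div_iff₀ hα]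
    nlinarith
  have hdα : d / α * 3 ≤ d / α * L := by gcongr
  intro fuel
  induction fuel with
  | zero => intro i s u _ h; omega
  | succ fuel ih =>
    intro i s u hi _ hfuel hs0 hinv
    have hp : (2 : ℝ) ≤ 2 ^ i := by
      calc (2 : ℝ) = 2 ^ 1 := by norm_num
        _ ≤ 2 ^ i := pow_le_pow_right₀ (by norm_num) hi
    have hp0 : (0 : ℝ) < 2 ^ i := by positivity
    have ha0 : 0 ≤ α * (1 - 2 / 2 ^ i) := by
      have : (2 : ℝ) / 2 ^ i ≤ 1 := (div_le_one hp0).2 hp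
      exact mul_nonneg hα.le (by linarith)
    have hs600 : 600 ≤ s := by
      have : (600 : ℝ) ≤ s := by linarith
      exact_mod_cast this
    by_cases hs : 300 * n ≤ s
    · have ha : α * (1 - 2 / 2 ^ i) ≤ α := by
        have : (0 : ℝ) < 2 / 2 ^ i := by positivity
        nlinarith
      refine (loopLoss_final_le hα.le hC hA μ c fuel i ha0 ha hs hs600 hCd.le
        (θ := α / 50) (by positivity) (by linarith)).trans ?_
      have hfin := finalBound_le hα hα1 hβ hβ1 hd hs0
      rw [← ENNReal.ofReal_add hβ.le (by
        unfold finalBound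
        have h1 := growthBound_nonneg d (θ := α / 50) (by positivity) (s / 300)
        have h2 := growthBound_nonneg d (θ := α / 50) (by positivity) (2 * (s / 300))
        have h3 : 0 ≤ (1 + 10 * α / 3)⁻¹ := by positivity
        have h4 : (1 + 10 * α / 3)⁻¹ ≤ 1 := inv_le_one_of_one_le₀ (by linarith)
        have h5 : 0 ≤ 1 - (1 - (1 + 10 * α / 3)⁻¹) * (1 / 4) := by linarith
        positivity)]
      refine ENNReal.ofReal_le_ofReal ?_
      have : 0 < β * (1 / 2 ^ i) := by positivity
      linarith
    · obtain ⟨hsi, hu⟩ := hinv (not_le.1 hs)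
      have hgrow := sample_growth hα hβ hd hL hi hsi
      obtain ⟨hv1, hv2, hv3⟩ := stretchSize_cases α β d n i s hgrow
      generalize hv : stretchSize α β d n i s = v at hv1 hv2 hv3
      set a := α / (10 * 2 ^ i) with ha
      set b := β / (4 * 2 ^ i) with hb
      set x := a * s / (200 * d) with hx
      have ha_pos : 0 < a := by positivity
      have hb_pos : 0 < b := by positivity
      have ha5 : a ≤ 1 / 5 := by
        rw [ha, div_le_iff₀ (by positivity)]
        linarith
      have hb1 : b ≤ 1 := by
        rw [hb, div_le_iff₀ (by positivity)]
        linarith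
      have hsd : 20000 * 4 ^ i * (d / α * 3) ≤ s :=
        le_trans (by gcongr) hsi
      have h4 : (4 : ℝ) ^ i = 2 ^ i * 2 ^ i := by rw [← mul_pow]; norm_num
      have hsd' : 60000 * (2 ^ i * 2 ^ i) * d ≤ s * α := by
        rw [h4] at hsd
        have h5 : 20000 * ((2 : ℝ) ^ i * 2 ^ i) * (d / α * 3) =
          60000 * (2 ^ i * 2 ^ i) * d / α := by ring
        rw [h5, div_le_iff₀ hα] at hsd
        exact hsd
      have hbe : 4000 * (60000 * (2 ^ i * 2 ^ i)) ≤ b * Real.exp x * α := by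
        have h6 : 4000 * (60000 * (2 ^ i * 2 ^ i)) * d ≤ b * Real.exp x * α * d := by
          have := mul_le_mul_of_nonneg_right hgrow hα.le
          linarith
        exact le_of_mul_le_mul_right h6 (by linarith)
      have hbig : 100 ≤ b * Real.exp x := by
        have h6 : 0 < b * Real.exp x := by positivity
        nlinarith
      have hxexp : 10 / a ≤ Real.exp (x - 2) := by
        have he2 : Real.exp 2 ≤ 8 := by
          have h3 : Real.exp 2 = Real.exp 1 ^ 2 := by rw [← Real.exp_nat_mul]; norm_num
          rw [h3]
          nlinarith [Real.exp_one_lt_d9, Real.exp_pos 1]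
        have h7 : 4000 * (60000 * (2 ^ i * 2 ^ i)) ≤ Real.exp x * α := by
          refine hbe.trans ?_
          have := mul_le_mul_of_nonneg_right hb1 (by positivity : 0 ≤ Real.exp x * α)
          linarith
        rw [Real.exp_sub, ha, div_div_eq_mul_div, div_le_div_iff₀ hα (Real.exp_pos 2)]
        nlinarith
      have hsx : a * s = 200 * d * x := by
        rw [hx]
        field_simp
      -- As s < 300n, the potential leaves u > 30000n, which is the cap on `v`.
      have hvu : v ≤ u := by omega
      have hG : ∀ y : Fin (s / 100 + v / 100) → X,
          ((traces C y).card : ℝ≥0∞) ≤ ENNReal.ofReal (b * Real.exp (d * x)) := by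
        intro y
        refine card_traces_iteration_le hCd.le hd hb_pos hb1 hbig y ?_
        rw [Fintype.card_fin, le_div_iff₀ (by norm_num)]
        refine le_trans ?_ hv3
        exact_mod_cast (by omega : (s / 100 + v / 100) * 100 ≤ s + v)
      have hη : (0 : ℝ) ≤ 10 * a := by positivity
      have hstep := loopLoss_succ_le α β hC A μ c fuel i ha0 hη hs
        (v := v) (by rw [hCd]; exact hv) hvu hG
      refine hstep.trans ?_
      have hanext : α * (1 - 2 / 2 ^ i) + 10 * a = α * (1 - 2 / 2 ^ (i + 1)) := by
        rw [ha, pow_succ]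
        field_simp
        ring
      -- Each iteration uses one unit of fuel and enlarges the sample by at least one.
      have hs'1 : s + 1 ≤ s / 100 + v / 100 := by
        rcases hv2 with h | h <;> omega
      have hrec := ih (i + 1) (s / 100 + v / 100) (u - v) (by omega) (by omega) (by omega)
        (hs0.trans (by exact_mod_cast (by omega : s ≤ s / 100 + v / 100))) (fun hlt => by
          -- If `v` is at its cap, one percent of it already gives 300n entries and the loop is
          -- over. Otherwise v ≥ 3999s, which gives the growth by 4 despite rounding and keeps the
          -- potential from decreasing.
          rcases hv2 with h | h
          · omega
          · refine ⟨?_, by omega⟩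
            rw [pow_succ]
            have h8 : (4 * s : ℝ) ≤ (s / 100 + v / 100 : ℕ) := by
              exact_mod_cast (by omega : 4 * s ≤ s / 100 + v / 100)
            refine le_trans ?_ h8
            linarith)
      rw [hanext]
      have hfar := piExpect_farPairs_le μ hCd.le (θ := a / 10) (by positivity) (by linarith) hη
        (s / 100)
      have hb2 : ENNReal.ofReal (b * Real.exp (d * x)) *
          (piExpect μ fun y : Fin (s / 100) → X => ⨆ e ∈ farPairs μ C (10 * a),
            penalty fun i => e (y i)) ≤ ENNReal.ofReal b := by
        refine (mul_le_mul_right hfar _).trans ?_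
        rw [← ENNReal.ofReal_mul (by positivity)]
        exact ENNReal.ofReal_le_ofReal
          (iteration_bound hd ha_pos ha5 hb_pos.le hxexp hsx _ rfl)
      refine (add_le_add hb2 hrec).trans ?_
      rw [← ENNReal.ofReal_add hb_pos.le (by positivity)]
      refine ENNReal.ofReal_le_ofReal (le_of_sub_nonneg ?_)
      have h9 : β * (3 / 2 + 1 / 2 ^ i) - (b + β * (3 / 2 + 1 / 2 ^ (i + 1))) =
          β / (4 * 2 ^ i) := by
        rw [hb, pow_succ]
        field_simp
        ring
      rw [h9]
      positivity

theorem isSSL_of_large {n m : ℕ} {α β : ℝ} (h : 1 ≤ α ∨ 1 ≤ β) (C : Set (Concept X))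
    (A : Learner X n) : IsSSL α β n m C A := by
  intro c _ μ
  rcases h with h | h
  · have hempty : {f | ENNReal.ofReal α < genError μ c f} = ∅ := by
      refine Set.eq_empty_iff_forall_notMem.2 fun f hf => ?_
      refine absurd hf (not_lt.2 ((toOuterMeasure_le_one μ _).trans ?_))
      rw [← ENNReal.ofReal_one]
      exact ENNReal.ofReal_le_ofReal h
    rw [hempty, MeasureTheory.measure_empty]
    exact zero_le
  · refine (toOuterMeasure_le_one _ _).trans ?_
    rw [← ENNReal.ofReal_one]
    exact ENNReal.ofReal_le_ofReal h

end Main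

end PrivateSSL

end

/-! ### Choice of the labelled sample size -/

theorem mainTheorem3 :
    ∃ K : ℝ, 0 < K ∧
      ∀ {X : Type*} (C : Set (PrivateSSL.Concept X)) (hC : C.Nonempty) (d : ℕ),
        PrivateSSL.vcDim C = d → 1 ≤ d →
        ∀ (α β δ : ℝ), 0 < α → α < 1 → 0 < β → β < 1 → 0 ≤ δ →
        ∀ (n : ℕ) (A : PrivateSSL.Learner X n),
          PrivateSSL.IsPSSL α β 1 δ n n C A →
          ∃ m : ℕ, (m : ℝ) ≤ K * (d / α * Real.log (1 / (α * β))) ∧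
            (d / α * Real.log (1 / (α * β)) ≤ n → ((m + 90000 * n : ℕ) : ℝ) ≤ K * n) ∧
            PrivateSSL.IsPSSL (11 * α) (2 * β) 1 (41 * δ) (m + 90000 * n) m C
              (PrivateSSL.labelBoost α β C hC A m) := by
  refine ⟨200000, by norm_num, ?_⟩
  intro X C hC d hCd hd α β δ hα hα1 hβ hβ1 hδ n A hA
  have hdp : ∀ m, PrivateSSL.IsDP 1 (41 * δ) (PrivateSSL.labelBoost α β C hC A m) := fun m =>
    PrivateSSL.labelBoost_isDP α β (by linarith) hC hA.2 m
  -- With 11α ≥ 1 or 2β ≥ 1 the accuracy requirement is void and m = 0 suffices; otherwise αβ <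
  -- 1/22, so the logarithm is at least 3.
  by_cases hbig : 1 ≤ 11 * α ∨ 1 ≤ 2 * β
  · refine ⟨0, ?_, fun _ => ?_, PrivateSSL.isSSL_of_large hbig C _, hdp 0⟩
    · have hlog : 0 ≤ Real.log (1 / (α * β)) := by
        refine Real.log_nonneg ?_
        rw [le_div_iff₀ (by positivity)]
        nlinarith
      push_cast
      positivity
    · push_cast
      linarith [Nat.cast_nonneg (α := ℝ) n]
  · rw [not_or, not_le, not_le] at hbig
    have hα11 : α < 1 / 11 := by linarith
    have hβ2 : β < 1 / 2 := by linarith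
    have hL := PrivateSSL.three_le_log_inv hα hα11 hβ hβ2
    have hd' : (1 : ℝ) ≤ d := by exact_mod_cast hd
    have hY : 1 ≤ d / α * Real.log (1 / (α * β)) := by
      rw [div_mul_eq_mul_div, le_div_iff₀ hα]
      nlinarith
    set Y := d / α * Real.log (1 / (α * β)) with hYdef
    -- The constant is 20000 · 4^i at i = 1, where the invariant of the loop starts. The initial
    -- radius is 0 and the initial failure bound is 2β.
    have hm1 : 80000 * Y ≤ ⌈80000 * Y⌉₊ := Nat.le_ceil _
    have hm2 : (⌈80000 * Y⌉₊ : ℝ) < 80000 * Y + 1 := Nat.ceil_lt_add_one (by positivity)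
    refine ⟨⌈80000 * Y⌉₊, by linarith, fun h => ?_, ?_, hdp _⟩
    · push_cast
      linarith
    · refine PrivateSSL.labelBoost_isSSL_of_loopLoss hC fun μ c => ?_
      have key := PrivateSSL.loopLoss_le hα hα11 hβ hβ2 hC hCd hd hA.1 μ c
        (⌈80000 * Y⌉₊ + 90000 * n + 1) 1 ⌈80000 * Y⌉₊ (90000 * n) le_rfl (by omega) (by omega) hm1
        (fun _ => ⟨by linarith, by omega⟩)
      norm_num at key
      convert key using 2
      ring
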